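/- Let $d\ge 1$ and let $\rho\ge 0$ be a probability density on $\mathbb R$ that is (essentially) bounded and has compact support. Let $\omega=(\omega_n)_{n\in\mathbb Z^d}$ be independent real random variables on a probability space $(\Omega,\mathcal A,\mathbb P)$, each with distribution $\rho(v)\,dv$, and let $\mathbb E$ denote expectation. On $\ell^2(\mathbb Z^d)$, with canonical basis $(e_x)_{x\in\mathbb Z^d}$, consider the Anderson Hamiltonian $$(h_\omega u)(n) = -\sum_{k\in\mathbb Z^d,\ |k|=1} u(n+k) + \omega_n u(n),\qquad |k|=|k_1|+\dots+|k_d|,$$ which is almost surely a bounded self-adjoint operator. For $x,y\in\mathbb Z^d$ let $\mu_{x,y}$ be its mixed spectral measure, i.e. the complex Borel measure $\mu_{x,y}(B)=\langle e_x,\chi_B(h_\omega)e_y\rangle$ on $\mathbb R$, and let $|\mu_{x,y}|$ be its total variation. For $L\in\mathbb N$ let $\Lambda_L=[-L,L]^d\cap\mathbb Z^d$, let $h_\omega^{\Lambda_L}$ be the restriction of $h_\omega$ to $\ell^2(\Lambda_L)$ (i.e. its matrix is $(\langle e_n,h_\omega e_m\rangle)_{n,m\in\Lambda_L}$), and for $x,y\in\Lambda_L$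 let $G_\omega^{\Lambda_L}(x,y;E)=\langle e_x,(h_\omega^{\Lambda_L}-E)^{-1}e_y\rangle$ be its Green function, defined for all real $E$ outside the finite spectrum of $h_\omega^{\Lambda_L}$. **Proposition.** Let $0<s<1$. There is a constant $C=C(s,\rho,d)<\infty$ such that for every bounded open interval $I\subset\mathbb R$ and all $x,y\in\mathbb Z^d$ the function $\omega\mapsto|\mu_{x,y}|(I)$ is measurable (up to modification on a null set) and $$\mathbb E\big(|\mu_{x,y}|(I)\big)\ \le\ C\,\liminf_{L\to\infty}\left(\int_I \mathbb E\big(|G_\omega^{\Lambda_L}(x,y;E)|^s\big)\,dE\right)^{\frac1{2-s}} .$$ -/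

import Mathlib

open MeasureTheory ProbabilityTheory Filter Topology
open scoped ENNReal NNReal CompactlySupported

noncomputable section

/-! ### Spectral measures of a bounded self-adjoint operator -/

section Spectral

variable {H : Type*} [NormedAddCommGroup H] [InnerProductSpace ℂ H] [CompleteSpace H]

/-- The positive linear functional `f ↦ ⟨ψ, f(T) ψ⟩` on real continuous compactly supported
functions, where `f(T)` is given by the continuous functional calculus of the self-adjoint
operator `T`. -/
def spectralFunctional (T : H →L[ℂ] H) (ψ : H) : C_c(ℝ, ℝ) →ₚ[ℝ] ℝ :=
  PositiveLinearMap.mk₀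
    { toFun := fun f => (inner ℂ ψ (cfc (fun t : ℝ => f t) T ψ)).re
      map_add' := by
        intro f g
        have h := cfc_add (R := ℝ) (a := T) (fun t => f t) (fun t => g t)
          f.continuous.continuousOn g.continuous.continuousOn
        have h' : (fun t : ℝ => (f + g) t) = fun t => f t + g t := rfl
        rw [h', h, add_apply, inner_add_right, Complex.add_re]
      map_smul' := by
        intro c f
        have h := cfc_smul (R := ℝ) (a := T) c (fun t => f t) f.continuous.continuousOn
        have h' : (fun t : ℝ => (c • f) t) = fun t => c • f t := rfl
        rw [h', h, smul_apply, inner_smul_right_eq_smul, Complex.smul_re]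
        rfl }
    (by
      intro f hf
      have h : (0 : H →L[ℂ] H) ≤ cfc (fun t : ℝ => f t) T := cfc_nonneg fun t _ => hf t
      exact ((ContinuousLinearMap.nonneg_iff_isPositive _).1 h).re_inner_nonneg_right ψ)

/-- The spectral measure of the self-adjoint operator `T` at the vector `ψ`: the Borel measure on
`ℝ` with `∫ f dμ = ⟨ψ, f(T) ψ⟩` for all `f ∈ C_c(ℝ)`, i.e. `μ(B) = ⟨ψ, χ_B(T) ψ⟩`. -/
def spectralMeasure (T : H →L[ℂ] H) (ψ : H) : Measure ℝ :=
  RealRMK.rieszMeasure (spectralFunctional T ψ)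

theorem integral_spectralMeasure (T : H →L[ℂ] H) (ψ : H) (f : C_c(ℝ, ℝ)) :
    ∫ t, f t ∂(spectralMeasure T ψ) = (inner ℂ ψ (cfc (fun t : ℝ => f t) T ψ)).re :=
  RealRMK.integral_rieszMeasure (spectralFunctional T ψ) f

theorem spectralFunctional_le (T : H →L[ℂ] H) (ψ : H) (f : C_c(ℝ, ℝ)) (hf : ∀ t, f t ≤ 1)
    (hf' : ∀ t, 0 ≤ f t) : spectralFunctional T ψ f ≤ ‖ψ‖ ^ 2 := by
  have h1 : ‖cfc (fun t : ℝ => f t) T‖ ≤ 1 :=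
    norm_cfc_le zero_le_one fun t _ => by
      rw [Real.norm_of_nonneg (hf' t)]; exact hf t
  calc (inner ℂ ψ (cfc (fun t : ℝ => f t) T ψ)).re
      ≤ ‖inner ℂ ψ (cfc (fun t : ℝ => f t) T ψ)‖ := Complex.re_le_norm _
    _ ≤ ‖ψ‖ * ‖cfc (fun t : ℝ => f t) T ψ‖ := norm_inner_le_norm _ _
    _ ≤ ‖ψ‖ * (1 * ‖ψ‖) := by
        gcongr
        exact (ContinuousLinearMap.le_opNorm _ _).trans (by gcongr)
    _ = ‖ψ‖ ^ 2 := by ring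

instance isFiniteMeasure_spectralMeasure (T : H →L[ℂ] H) (ψ : H) :
    IsFiniteMeasure (spectralMeasure T ψ) := by
  have : (spectralMeasure T ψ).Regular := by
    unfold spectralMeasure; infer_instance
  refine ⟨lt_of_le_of_lt ?_ (ENNReal.ofReal_lt_top (r := ‖ψ‖ ^ 2))⟩
  rw [isOpen_univ.measure_eq_iSup_isCompact]
  refine iSup₂_le fun K _ => iSup_le fun hK => ?_
  obtain ⟨f, hfK, -, hfc, hf⟩ := exists_continuous_one_zero_of_isCompact hK isClosed_empty
    (Set.disjoint_empty K)
  let g : C_c(ℝ, ℝ) := ⟨f, hfc⟩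
  refine (RealRMK.rieszMeasure_le_of_eq_one (spectralFunctional T ψ) (f := g)
    (fun t => (hf t).1) hK (fun t ht => hfK ht)).trans ?_
  exact ENNReal.ofReal_le_ofReal
    (spectralFunctional_le T ψ g (fun t => (hf t).2) (fun t => (hf t).1))

/-- The mixed spectral measure `B ↦ ⟨φ, χ_B(T) ψ⟩` of a bounded self-adjoint operator `T`, a complex
Borel measure on `ℝ`, obtained from the spectral measures by polarization:
`4⟨φ, Aψ⟩ = ⟨φ+ψ, A(φ+ψ)⟩ - ⟨φ-ψ, A(φ-ψ)⟩ + i (⟨φ-iψ, A(φ-iψ)⟩ - ⟨φ+iψ, A(φ+iψ)⟩)`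
(the inner product is conjugate-linear in its first argument). -/
def mixedSpectralMeasure (T : H →L[ℂ] H) (φ ψ : H) : ComplexMeasure ℝ :=
  SignedMeasure.toComplexMeasure
    ((1 / 4 : ℝ) • ((spectralMeasure T (φ + ψ)).toSignedMeasure
      - (spectralMeasure T (φ - ψ)).toSignedMeasure))
    ((1 / 4 : ℝ) • ((spectralMeasure T (φ - Complex.I • ψ)).toSignedMeasure
      - (spectralMeasure T (φ + Complex.I • ψ)).toSignedMeasure))

/-- The defining property of the mixed spectral measure `μ`: for all `f ∈ C_c(ℝ)` one has
`∫ f d(Re μ) + i ∫ f d(Im μ) = ⟨φ, f(T) ψ⟩`. -/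
theorem mixedSpectralMeasure_spec (T : H →L[ℂ] H) (φ ψ : H) (f : C_c(ℝ, ℝ)) :
    (((1 / 4 : ℝ) * ((∫ t, f t ∂spectralMeasure T (φ + ψ))
        - ∫ t, f t ∂spectralMeasure T (φ - ψ)) : ℝ) : ℂ)
      + (((1 / 4 : ℝ) * ((∫ t, f t ∂spectralMeasure T (φ - Complex.I • ψ))
        - ∫ t, f t ∂spectralMeasure T (φ + Complex.I • ψ)) : ℝ) : ℂ) * Complex.I
      = inner ℂ φ (cfc (fun t : ℝ => f t) T ψ) := by
  simp only [integral_spectralMeasure]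
  have hs : IsSelfAdjoint (cfc (fun t : ℝ => f t) T) := cfc_predicate _ _
  set A := cfc (fun t : ℝ => f t) T
  have hsym := hs.isSymmetric
  have h1 : inner ℂ ψ (A φ) = starRingEnd ℂ (inner ℂ φ (A ψ)) := by
    rw [inner_conj_symm]; exact (hsym ψ φ).symm
  simp only [map_add, map_sub, map_smul, inner_add_left, inner_add_right, inner_sub_left,
    inner_sub_right, inner_smul_left, inner_smul_right, h1]
  apply Complex.ext
  · simp [-inner_conj_symm]
    ring
  · simp [-inner_conj_symm]
    ring

end Spectral

/-! ### The Anderson Hamiltonian -/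

/-- The Hilbert space `ℓ²(ℤ^d)`. -/
abbrev LatticeL2 (d : ℕ) : Type := lp (fun _ : Fin d → ℤ => ℂ) 2

/-- The canonical basis vector `e_x` of `ℓ²(ℤ^d)`. -/
def basisVec {d : ℕ} (x : Fin d → ℤ) : LatticeL2 d := lp.single 2 x (1 : ℂ)

/-- The translation operator `(τ_k u)(n) = u(n + k)` on `ℓ²(ℤ^d)`. -/
def translationOp {d : ℕ} (k : Fin d → ℤ) : LatticeL2 d →L[ℂ] LatticeL2 d :=
  LinearMap.mkContinuous
    { toFun := fun u => ⟨fun n => u (n + k), by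
        have h := (memℓp_gen_iff (p := 2) (by norm_num)).1 (lp.memℓp u)
        exact (memℓp_gen_iff (p := 2) (by norm_num)).2
          ((Equiv.addRight k).summable_iff.2 h)⟩
      map_add' := fun _ _ => rfl
      map_smul' := fun _ _ => rfl }
    1 (by
      intro u
      rw [one_mul, lp.norm_eq_tsum_rpow (by norm_num), lp.norm_eq_tsum_rpow (by norm_num)]
      exact le_of_eq (congrArg (· ^ (1 / (2 : ℝ≥0∞).toReal))
        ((Equiv.addRight k).tsum_eq fun n => ‖u n‖ ^ (2 : ℝ≥0∞).toReal)))

/-- The operator of multiplication by a bounded function `V` on `ℓ²(ℤ^d)`. -/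
def boundedMulOp {d : ℕ} (V : (Fin d → ℤ) → ℝ) (M : ℝ) (hM : ∀ n, |V n| ≤ M) :
    LatticeL2 d →L[ℂ] LatticeL2 d :=
  LinearMap.mkContinuous
    { toFun := fun u => ⟨fun n => (V n : ℂ) * u n, by
        refine Memℓp.mono' (g := fun n => (M : ℂ) * u n) ((lp.memℓp u).const_mul (M : ℂ)) ?_
        intro n
        rw [norm_mul, norm_mul, Complex.norm_real, Complex.norm_real, Real.norm_eq_abs,
          Real.norm_eq_abs]
        exact mul_le_mul_of_nonneg_right ((hM n).trans (le_abs_self M)) (norm_nonneg _)⟩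
      map_add' := fun u v => by
        ext n; exact mul_add _ _ _
      map_smul' := fun c u => by
        ext n; exact mul_left_comm _ _ _ }
    |M| (by
      intro u
      have h : ‖(M : ℂ) • u‖ = |M| * ‖u‖ := by
        rw [norm_smul, Complex.norm_real, Real.norm_eq_abs]
      rw [← h]
      refine lp.norm_mono (by norm_num) fun n => ?_
      change ‖(V n : ℂ) * u n‖ ≤ ‖(M : ℂ) * u n‖
      rw [norm_mul, norm_mul, Complex.norm_real, Complex.norm_real, Real.norm_eq_abs,
        Real.norm_eq_abs]
      exact mul_le_mul_of_nonneg_right ((hM n).trans (le_abs_self M)) (norm_nonneg _))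

/-- The discrete Laplacian `(h₀ u)(n) = - ∑_{|k|=1} u(n + k)` on `ℓ²(ℤ^d)`; the `k ∈ ℤ^d` with
`|k| = |k_1| + ... + |k_d| = 1` are the vectors `± e_j`. -/
def discreteLaplacian (d : ℕ) : LatticeL2 d →L[ℂ] LatticeL2 d :=
  -∑ j : Fin d, (translationOp (Pi.single j 1) + translationOp (-Pi.single j 1))

open Classical in
/-- The Schrödinger operator `h = h₀ + V` on `ℓ²(ℤ^d)` for a bounded potential `V : ℤ^d → ℝ`.
(For an unbounded `V` the potential term is dropped; for i.i.d. potentials with compactly supported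
distribution this concerns a null set only.) -/
def andersonOp {d : ℕ} (V : (Fin d → ℤ) → ℝ) : LatticeL2 d →L[ℂ] LatticeL2 d :=
  if h : ∃ M : ℝ, ∀ n, |V n| ≤ M then
    discreteLaplacian d + boundedMulOp V h.choose h.choose_spec
  else discreteLaplacian d

theorem andersonOp_apply {d : ℕ} (V : (Fin d → ℤ) → ℝ) (M : ℝ) (hM : ∀ n, |V n| ≤ M)
    (u : LatticeL2 d) (n : Fin d → ℤ) :
    andersonOp V u n
      = -∑ j : Fin d, (u (n + Pi.single j 1) + u (n - Pi.single j 1)) + V n * u n := by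
  have h : ∃ M : ℝ, ∀ n, |V n| ≤ M := ⟨M, hM⟩
  rw [andersonOp, dif_pos h]
  change (discreteLaplacian d u) n + V n * u n = _
  congr 1
  simp only [discreteLaplacian, neg_apply, sum_apply, lp.coeFn_neg, lp.coeFn_sum, Pi.neg_apply,
    Finset.sum_apply]
  rfl

theorem isSelfAdjoint_andersonOp {d : ℕ} (V : (Fin d → ℤ) → ℝ) : IsSelfAdjoint (andersonOp V) := by
  rw [ContinuousLinearMap.isSelfAdjoint_iff_isSymmetric]
  have hmul : ∀ M hM (u v : LatticeL2 d),
      inner ℂ (boundedMulOp V M hM u) v = inner ℂ u (boundedMulOp V M hM v) := by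
    intro M hM u v
    rw [lp.inner_eq_tsum, lp.inner_eq_tsum]
    refine tsum_congr fun n => ?_
    change inner ℂ ((V n : ℂ) * u n) (v n) = inner ℂ (u n) ((V n : ℂ) * v n)
    simp [mul_left_comm, mul_assoc]
  have htr : ∀ (k : Fin d → ℤ) (u v : LatticeL2 d),
      inner ℂ (translationOp k u) v = inner ℂ u (translationOp (-k) v) := by
    intro k u v
    rw [lp.inner_eq_tsum, lp.inner_eq_tsum,
      ← (Equiv.addRight k).tsum_eq (fun n => inner ℂ (u n) ((translationOp (-k) v) n))]
    refine tsum_congr fun n => ?_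
    change inner ℂ (u (n + k)) (v n) = inner ℂ (u (n + k)) (v (n + k + -k))
    simp
  have hlap : ∀ u v, inner ℂ (discreteLaplacian d u) v = inner ℂ u (discreteLaplacian d v) := by
    intro u v
    simp only [discreteLaplacian, neg_apply, sum_apply, inner_neg_left, inner_neg_right, sum_inner,
      inner_sum, add_apply, inner_add_left, inner_add_right, htr, neg_neg]
    congr 1
    exact Finset.sum_congr rfl fun _ _ => add_comm _ _
  intro u v
  change inner ℂ (andersonOp V u) v = inner ℂ u (andersonOp V v)
  unfold andersonOp
  split_ifs with h
  · simp only [add_apply, inner_add_left, inner_add_right, hlap, hmul]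
  · exact hlap u v

/-! ### Finite volume restrictions -/

/-- The box `Λ_L = [-L, L]^d ∩ ℤ^d`. -/
def latticeBox (d L : ℕ) : Finset (Fin d → ℤ) :=
  Finset.Icc (fun _ => -(L : ℤ)) (fun _ => (L : ℤ))

/-- The matrix of the restriction of `h₀ + V` to `ℓ²(Λ_L)` in the canonical basis. -/
def boxHamiltonian {d : ℕ} (V : (Fin d → ℤ) → ℝ) (L : ℕ) :
    Matrix (latticeBox d L) (latticeBox d L) ℂ :=
  Matrix.of fun n m =>
    (if ∑ i, |n.1 i - m.1 i| = 1 then -1 else 0) + (if n = m then (V n.1 : ℂ) else 0)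

open Classical in
/-- The Green function `G^{Λ_L}(x, y; E) = ⟨e_x, (h^{Λ_L} - E)⁻¹ e_y⟩` at real energy `E`, for
`x, y ∈ Λ_L`. (It is set to `0` if `x ∉ Λ_L` or `y ∉ Λ_L`, which for given `x, y` concerns finitely
many `L`, and at the finitely many `E` that are eigenvalues of `h^{Λ_L}`.) -/
def boxGreen {d : ℕ} (V : (Fin d → ℤ) → ℝ) (L : ℕ) (x y : Fin d → ℤ) (E : ℝ) : ℂ :=
  if h : x ∈ latticeBox d L ∧ y ∈ latticeBox d L then
    (boxHamiltonian V L - (E : ℂ) • (1 : Matrix (latticeBox d L) (latticeBox d L) ℂ))⁻¹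
      ⟨x, h.1⟩ ⟨y, h.2⟩
  else 0

/-! ### The random potential -/

/-- `ρ` is a probability density on `ℝ` in `L^∞_0(ℝ)`, i.e. (essentially) bounded and vanishing
almost everywhere outside a compact set. -/
structure IsBoundedCompactDensity (ρ : ℝ → ℝ) : Prop where
  memLp_top : MemLp ρ ∞ volume
  nonneg : ∀ᵐ v, 0 ≤ ρ v
  compact_support : ∃ K : Set ℝ, IsCompact K ∧ ∀ᵐ v, v ∉ K → ρ v = 0
  integral_eq_one : ∫ v, ρ v = 1

/-- `(ω_n)_{n ∈ ℤ^d}` are independent real random variables on the probability space `(Ω, P)`, each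
of which has distribution `ρ(v) dv`. -/
structure IsIIDPotential {d : ℕ} {Ω : Type*} [MeasurableSpace Ω] (P : Measure Ω)
    (ω : (Fin d → ℤ) → Ω → ℝ) (ρ : ℝ → ℝ) : Prop where
  measurable : ∀ n, Measurable (ω n)
  indep : iIndepFun ω P
  law : ∀ n, P.map (ω n) = volume.withDensity fun v => ENNReal.ofReal (ρ v)

end

/-!
Let `A = K + v |e_x⟩⟨e_x|` be a Hermitian matrix with eigenvalue `λ` and eigenvector `ψ`. Comparing
the eigenvalue equation with the matrix in which `v` is replaced by `w` gives
`ψ(y) = (w - v) G_w(y, x; λ) ψ(x)`. Hölder's inequality therefore bounds the power `2 - s` of the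
eigenfunction correlator `∑_{λ ∈ U} |ψ_λ(x)| |ψ_λ(y)|` by
`∑_{λ ∈ U} |ψ_λ(x)|^(2-s) |ψ_λ(y)|^s = ∫_U |w - v|^s |G_w(x, y; E)|^s μ_v(dE)`,
where `μ_v` is the spectral measure of `A` at `e_x`. By spectral averaging `∫ μ_v dv ≤ dE`, so
averaging first over `v` and then over an independent copy `w` of it leaves the fractional moment of
the Green function; Jensen's inequality moves the power to the right-hand side.

On an open set the total variation is a supremum over finite families of test functions, hence lower
semicontinuous when the box Hamiltonians converge strongly to the Hamiltonian on `ℤ^d`, and Fatou's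
lemma carries the bound to infinite volume.
-/

/-! ### The variation of a vector measure through test functions -/

section Variation

variable {X F : Type*} [TopologicalSpace X]

/-- Families of `n` compactly supported continuous functions with `|f₁| + ⋯ + |fₙ| ≤ χ_U`, against
which `testVariation` is computed. -/
def testFamilies (U : Set X) (n : ℕ) : Set (Fin n → C(X, ℝ)) :=
  {f | (∀ i, HasCompactSupport (f i)) ∧ ∀ t, ∑ i, ‖f i t‖ₑ ≤ U.indicator 1 t}

/-- The total variation on `U` of a functional `Φ` on continuous functions, computed with test
functions only. For open `U` and `Φ` integration against a vector measure `μ`, this is the variation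
of `μ`, see `variation_eq_testVariation`. -/
noncomputable def testVariation [ENorm F] (U : Set X) (Φ : C(X, ℝ) → F) : ℝ≥0∞ :=
  ⨆ n, ⨆ f ∈ testFamilies U n, ∑ i, ‖Φ (f i)‖ₑ

theorem testVariation_le [ENorm F] {U : Set X} {Φ : C(X, ℝ) → F} {c : ℝ≥0∞}
    (h : ∀ n, ∀ f ∈ testFamilies U n, ∑ i, ‖Φ (f i)‖ₑ ≤ c) : testVariation U Φ ≤ c :=
  iSup_le fun n => iSup₂_le (h n)

theorem sum_enorm_le_testVariation [ENorm F] {ι : Type*} [Fintype ι] {U : Set X}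
    (Φ : C(X, ℝ) → F) {f : ι → C(X, ℝ)} (hf : ∀ i, HasCompactSupport (f i))
    (hfU : ∀ t, ∑ i, ‖f i t‖ₑ ≤ U.indicator 1 t) :
    ∑ i, ‖Φ (f i)‖ₑ ≤ testVariation U Φ := by
  set e := (Fintype.equivFin ι).symm
  have hmem : f ∘ e ∈ testFamilies U (Fintype.card ι) :=
    ⟨fun i => hf (e i), fun t => (e.sum_comp fun i => ‖f i t‖ₑ).trans_le (hfU t)⟩
  rw [← e.sum_comp]
  exact le_iSup_of_le _ (le_iSup₂_of_le _ hmem le_rfl)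

theorem testVariation_congr [ENorm F] {U : Set X} {Φ Ψ : C(X, ℝ) → F}
    (h : ∀ f : C(X, ℝ), HasCompactSupport f → Φ f = Ψ f) :
    testVariation U Φ = testVariation U Ψ :=
  iSup_congr fun _ => biSup_congr fun f hf => Finset.sum_congr rfl fun i _ => by
    rw [h (f i) (hf.1 i)]

theorem testVariation_le_liminf [SeminormedAddGroup F] {ι : Type*} {l : Filter ι} (U : Set X)
    {Φ : ι → C(X, ℝ) → F} {Ψ : C(X, ℝ) → F} (h : ∀ f : C(X, ℝ), HasCompactSupport f →
      Tendsto (fun i => Φ i f) l (𝓝 (Ψ f))) :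
    testVariation U Ψ ≤ liminf (fun i => testVariation U (Φ i)) l := by
  refine testVariation_le fun n f hf => ?_
  have hlim : Tendsto (fun i => ∑ j, ‖Φ i (f j)‖ₑ) l (𝓝 (∑ j, ‖Ψ (f j)‖ₑ)) :=
    tendsto_finsetSum _ fun j _ => (h (f j) (hf.1 j)).enorm
  rcases l.eq_or_neBot with rfl | _
  · simp
  rw [← hlim.liminf_eq]
  exact liminf_le_liminf (Eventually.of_forall fun i => sum_enorm_le_testVariation _ hf.1 hf.2)

theorem lowerSemicontinuous_testVariation {α : Type*} [TopologicalSpace α]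
    [SeminormedAddGroup F] (U : Set X) {Φ : α → C(X, ℝ) → F}
    (hΦ : ∀ f, Continuous fun a => Φ a f) :
    LowerSemicontinuous fun a => testVariation U (Φ a) :=
  lowerSemicontinuous_iSup fun _ => lowerSemicontinuous_biSup fun f _ =>
    (continuous_finsetSum _ fun i _ => (hΦ (f i)).enorm).lowerSemicontinuous

theorem aemeasurable_testVariation {α : Type*} [MeasurableSpace α] {m : Measure α}
    [SecondCountableTopology C(X, ℝ)] [SeminormedAddGroup F] [MeasurableSpace F]
    [OpensMeasurableSpace F] (U : Set X) {Φ : α → C(X, ℝ) → F} (hΦ : ∀ a, Continuous (Φ a))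
    (hmeas : ∀ f, AEMeasurable (fun a => Φ a f) m) :
    AEMeasurable (fun a => testVariation U (Φ a)) m := by
  refine AEMeasurable.iSup fun n => ?_
  have hcont : ∀ a, Continuous fun f : testFamilies U n => ∑ i, ‖Φ a (f.1 i)‖ₑ := fun a =>
    continuous_finsetSum _ fun i _ =>
      ((hΦ a).comp ((continuous_apply i).comp continuous_subtype_val)).enorm
  obtain ⟨D, hDc, hD⟩ := TopologicalSpace.exists_countable_dense (testFamilies U n)
  have := hDc.to_subtype
  have heq : ∀ a, ⨆ f ∈ testFamilies U n, ∑ i, ‖Φ a (f i)‖ₑ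
      = ⨆ f : D, ∑ i, ‖Φ a (f.1.1 i)‖ₑ := fun a => by
    rw [iSup_subtype', hD.ciSup' (hcont a)]
  simp only [heq]
  exact AEMeasurable.iSup fun f => Finset.aemeasurable_fun_sum _ fun i _ => (hmeas _).enorm

end Variation

theorem eventually_thickening_subset_and_pairwise_disjoint {X ι : Type*} [PseudoMetricSpace X]
    [Finite ι] {U : Set X} (hU : IsOpen U) {K : ι → Set X} (hK : ∀ i, IsCompact (K i))
    (hKc : ∀ i, IsClosed (K i)) (hKU : ∀ i, K i ⊆ U) (hKd : Pairwise (Function.onFun Disjoint K)) :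
    ∀ᶠ δ in 𝓝[>] (0 : ℝ), (∀ i, Metric.thickening δ (K i) ⊆ U) ∧
      Pairwise (Function.onFun Disjoint fun i => Metric.thickening δ (K i)) := by
  refine (eventually_all.2 fun i => ?_).and (eventually_all.2 fun i => eventually_all.2 fun j => ?_)
  · obtain ⟨δ, hδ, h⟩ := (hK i).exists_thickening_subset_open hU (hKU i)
    filter_upwards [Ioo_mem_nhdsGT hδ] with r hr
    exact (Metric.thickening_mono hr.2.le _).trans h
  · rcases eq_or_ne i j with hij | hij
    · exact Eventually.of_forall fun _ h => absurd hij h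
    obtain ⟨δ, hδ, h⟩ := (hKd hij).exists_thickenings (hK i) (hKc j)
    filter_upwards [Ioo_mem_nhdsGT hδ] with r hr _
    exact h.mono (Metric.thickening_mono hr.2.le _) (Metric.thickening_mono hr.2.le _)

section VariationEq

open VectorMeasure ContinuousLinearMap

variable {X F : Type*} [PseudoMetricSpace X] [MeasurableSpace X] [BorelSpace X]
  [NormedAddCommGroup F] (μ : VectorMeasure X F)

theorem exists_isCompact_enorm_le_add [T2Space X] [ProperSpace X] [IsFiniteMeasure μ.variation]
    {A : Set X} (hA : MeasurableSet A) {ε : ℝ≥0∞} (hε : ε ≠ 0) :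
    ∃ K ⊆ A, IsCompact K ∧ ‖μ A‖ₑ ≤ ‖μ K‖ₑ + ε := by
  obtain ⟨K, hKA, hK, hKε⟩ := hA.exists_isCompact_sdiff_lt (measure_ne_top μ.variation A) hε
  refine ⟨K, hKA, hK, ?_⟩
  rw [← of_add_of_sdiff hK.measurableSet hA hKA]
  grw [enorm_add_le, enorm_measure_le_variation μ (A \ K), hKε]

variable [NormedSpace ℝ F]

theorem testVariation_integral_le_variation {U : Set X} (hU : MeasurableSet U) :
    testVariation U (fun f => ∫ᵛ t, f t ∂•μ) ≤ μ.variation U :=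
  testVariation_le fun n f hf => calc
    ∑ i, ‖∫ᵛ t, f i t ∂•μ‖ₑ
      ≤ ∑ i, ∫⁻ t, ‖f i t‖ₑ ∂μ.variation := by
        refine Finset.sum_le_sum fun i _ => ?_
        grw [enorm_integral_le_lintegral_enorm_transpose, variation_transpose_lsmul]
    _ = ∫⁻ t, ∑ i, ‖f i t‖ₑ ∂μ.variation :=
        (lintegral_finsetSum _ fun i _ => (f i).continuous.measurable.enorm).symm
    _ ≤ ∫⁻ t, U.indicator 1 t ∂μ.variation := lintegral_mono hf.2
    _ = μ.variation U := lintegral_indicator_one hU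

variable [CompleteSpace F] [IsFiniteMeasure μ.variation]

theorem tendsto_integral_thickenedIndicator {δ : ℕ → ℝ} (hδ : ∀ m, 0 < δ m)
    (hδ0 : Tendsto δ atTop (𝓝 0)) {K : Set X} (hK : IsClosed K) :
    Tendsto (fun m => ∫ᵛ t, (thickenedIndicator (hδ m) K t : ℝ) ∂•μ) atTop (𝓝 (μ K)) := by
  have hKμ : ∫ᵛ t, K.indicator (fun _ => (1 : ℝ)) t ∂•μ = μ K := by
    rw [VectorMeasure.integral_eq_setToFun,
      setToFun_indicator_const _ hK.measurableSet (measure_ne_top _ _)]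
    exact one_smul ℝ (μ K)
  rw [← hKμ]
  refine tendsto_integral_filter_of_norm_le_const (Eventually.of_forall fun m => ?_)
    ⟨1, Eventually.of_forall fun m => ae_of_all _ fun t => ?_⟩ (ae_of_all _ fun t => ?_)
  · fun_prop
  · simpa using thickenedIndicator_le_one (hδ m) K t
  · have := tendsto_pi_nhds.1 (thickenedIndicator_tendsto_indicator_closure hδ hδ0 K) t
    rw [hK.closure_eq] at this
    have hcoe : ((K.indicator (fun _ => 1) t : ℝ≥0) : ℝ) = K.indicator (fun _ => 1) t := by
      by_cases ht : t ∈ K <;> simp [ht]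
    rw [← hcoe]
    exact (NNReal.continuous_coe.tendsto _).comp this

variable [ProperSpace X]

theorem sum_enorm_isCompact_le_testVariation {ι : Type*} [Fintype ι] {U : Set X} (hU : IsOpen U)
    {K : ι → Set X} (hK : ∀ i, IsCompact (K i)) (hKc : ∀ i, IsClosed (K i)) (hKU : ∀ i, K i ⊆ U)
    (hKd : Pairwise (Function.onFun Disjoint K)) :
    ∑ i, ‖μ (K i)‖ₑ ≤ testVariation U (fun f => ∫ᵛ t, f t ∂•μ) := by
  have hδ : ∀ m : ℕ, (0 : ℝ) < 1 / ((m : ℝ) + 1) := fun m => by positivity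
  have hδ0 := tendsto_one_div_add_atTop_nhds_zero_nat (𝕜 := ℝ)
  refine le_of_tendsto (tendsto_finsetSum _ fun i _ =>
    (tendsto_integral_thickenedIndicator μ hδ hδ0 (hKc i)).enorm) ?_
  filter_upwards [(tendsto_nhdsWithin_iff.2 ⟨hδ0, Eventually.of_forall hδ⟩).eventually
    (eventually_thickening_subset_and_pairwise_disjoint hU hK hKc hKU hKd)] with m ⟨hmU, hmd⟩
  let f : ι → C(X, ℝ) := fun i => ⟨fun t => thickenedIndicator (hδ m) (K i) t, by fun_prop⟩
  have hzero : ∀ i t, t ∉ Metric.thickening (1 / ((m : ℝ) + 1)) (K i) → f i t = 0 := fun i t ht =>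
    NNReal.coe_eq_zero.2 (thickenedIndicator_zero (hδ m) (K i) ht)
  have hone : ∀ i t, ‖f i t‖ₑ ≤ 1 := fun i t => by
    rw [← ENNReal.coe_one, enorm_le_coe, ← NNReal.coe_le_coe, coe_nnnorm]
    simpa [f] using thickenedIndicator_le_one (hδ m) (K i) t
  refine sum_enorm_le_testVariation (fun f => ∫ᵛ t, f t ∂•μ) (f := f) (fun i => ?_) fun t => ?_
  · exact HasCompactSupport.intro (hK i).cthickening fun t ht =>
      hzero i t fun h => ht (Metric.thickening_subset_cthickening _ _ h)
  · by_cases ht : ∃ i, t ∈ Metric.thickening (1 / ((m : ℝ) + 1)) (K i)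
    · obtain ⟨i, hi⟩ := ht
      rw [Set.indicator_of_mem (hmU i hi), Finset.sum_eq_single i (fun j _ hj => ?_) (by simp)]
      · exact hone i t
      · rw [hzero j t (Set.disjoint_left.1 (hmd hj.symm) hi), enorm_zero]
    · simp [fun i => hzero i t fun h => ht ⟨i, h⟩]

theorem variation_eq_testVariation [T2Space X] {U : Set X} (hU : IsOpen U) :
    μ.variation U = testVariation U (fun f => ∫ᵛ t, f t ∂•μ) := by
  refine le_antisymm ?_ (testVariation_integral_le_variation μ hU.measurableSet)
  refine ENNReal.le_of_forall_pos_le_add fun ε hε _ => ?_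
  have hε' : (ε / 2 : ℝ≥0∞) ≠ 0 := by simpa using hε.ne'
  obtain ⟨P, hPU, hPd, hPm, hP⟩ := μ.exists_variation_le_add' hU.measurableSet
    (pos_iff_ne_zero.2 hε') (measure_ne_top _ _)
  obtain ⟨η, hη, hηsum⟩ := ENNReal.exists_pos_sum_of_countable hε' P
  choose K hKA hK hKη using fun A : P =>
    exists_isCompact_enorm_le_add μ (hPm A A.2) (ENNReal.coe_ne_zero.2 (hη A).ne')
  have hKd : Pairwise (Function.onFun Disjoint K) := fun A B hAB =>
    (hPd A.2 B.2 (Subtype.coe_ne_coe.2 hAB)).mono (hKA A) (hKA B)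
  calc μ.variation U
      ≤ ∑ A : P, ‖μ A‖ₑ + ε / 2 := by rwa [Finset.sum_coe_sort P fun A => ‖μ A‖ₑ]
    _ ≤ ∑ A : P, (‖μ (K A)‖ₑ + η A) + ε / 2 := by gcongr with A; exact hKη A
    _ = ∑ A : P, ‖μ (K A)‖ₑ + (∑ A : P, (η A : ℝ≥0∞) + ε / 2) := by
        rw [Finset.sum_add_distrib, add_assoc]
    _ ≤ testVariation U (fun f => ∫ᵛ t, f t ∂•μ) + (ε / 2 + ε / 2) := by
        gcongr
        · exact sum_enorm_isCompact_le_testVariation μ hU hK (fun A => (hK A).isClosed)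
            (fun A => (hKA A).trans (hPU A A.2)) hKd
        · rw [← tsum_fintype (L := .unconditional P)]
          simpa using hηsum.le
    _ = testVariation U (fun f => ∫ᵛ t, f t ∂•μ) + ε := by rw [ENNReal.add_halves]

end VariationEq

section Integral

open VectorMeasure ContinuousLinearMap

variable {X F G : Type*} [MeasurableSpace X] [NormedAddCommGroup F] [NormedSpace ℝ F]
  [NormedAddCommGroup G] [NormedSpace ℝ G] (μ : VectorMeasure X F) (L : F →L[ℝ] G)

theorem variation_mapRange_le :
    (μ.mapRange (L : F →+ G) L.continuous).variation ≤ ‖L‖ₑ • μ.variation :=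
  variation_le_of_forall_enorm_le fun s _ =>
    (L.le_opENorm (μ s)).trans <| mul_le_mul_right (enorm_measure_le_variation μ s) _

theorem integral_mapRange [CompleteSpace F] [CompleteSpace G] {f : X → ℝ} (hf : μ.Integrable f) :
    ∫ᵛ t, f t ∂•(μ.mapRange (L : F →+ G) L.continuous) = L (∫ᵛ t, f t ∂•μ) := by
  have hT := dominatedFinMeasAdditive_cbmApplyMeasure μ (lsmul ℝ ℝ)
  have hT' := ((dominatedFinMeasAdditive_cbmApplyMeasure (μ.mapRange (L : F →+ G) L.continuous)
    (lsmul ℝ ℝ)).of_measure_le (variation_mapRange_le μ L) (by positivity)).of_smul_measure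
    enorm_ne_top
  rw [VectorMeasure.integral_eq_setToFun, VectorMeasure.integral_eq_setToFun,
    ← setToFun_congr_measure_of_integrable ‖L‖ₑ enorm_ne_top (variation_mapRange_le μ L) hT' _ _ hf]
  refine hf.induction (P := fun f => setToFun _ _ hT' f = L (setToFun _ _ hT f))
    (fun c s hs hμs => ?_) (fun f g _ hf hg ihf ihg => ?_) ?_ fun f g hfg _ ih => ?_
  · rw [setToFun_indicator_const hT' hs hμs.ne, setToFun_indicator_const hT hs hμs.ne]
    exact (map_smul L c (μ s)).symm
  · rw [setToFun_add hT' hf hg, setToFun_add hT hf hg, _root_.map_add, ihf, ihg]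
  · exact isClosed_eq (continuous_setToFun hT') (L.continuous.comp (continuous_setToFun hT))
  · rw [← setToFun_congr_ae hT' hfg, ← setToFun_congr_ae hT hfg, ih]

end Integral

section ComplexMeasure

open VectorMeasure ContinuousLinearMap

variable {X : Type*} [MeasurableSpace X]

instance isFiniteMeasure_variation (c : ComplexMeasure X) : IsFiniteMeasure c.variation := by
  have hle : c.variation ≤ (ComplexMeasure.re c).variation + (ComplexMeasure.im c).variation :=
    variation_le_of_forall_enorm_le fun s _ => calc
      ‖c s‖ₑ ≤ ‖(c s).re‖ₑ + ‖(c s).im‖ₑ := by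
        simp only [← ofReal_norm, ← ENNReal.ofReal_add (norm_nonneg _) (norm_nonneg _)]
        exact ENNReal.ofReal_le_ofReal (Complex.norm_le_abs_re_add_abs_im _)
      _ ≤ _ := add_le_add (enorm_measure_le_variation (ComplexMeasure.re c) s)
        (enorm_measure_le_variation (ComplexMeasure.im c) s)
  rw [← SignedMeasure.totalVariation_eq_variation, ← SignedMeasure.totalVariation_eq_variation]
    at hle
  exact isFiniteMeasure_of_le _ hle

theorem integral_complexMeasure {f : X → ℝ} (c : ComplexMeasure X) (hf : c.Integrable f) :
    ∫ᵛ t, f t ∂•c = (∫ᵛ t, f t ∂•(ComplexMeasure.re c) : ℝ)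
      + (∫ᵛ t, f t ∂•(ComplexMeasure.im c) : ℝ) * Complex.I := by
  have hre := integral_mapRange c Complex.reCLM hf
  have him := integral_mapRange c Complex.imCLM hf
  apply Complex.ext
  · simpa using! hre.symm
  · simpa using! him.symm

theorem integral_smul_toSignedMeasure_sub {f : X → ℝ} (r : ℝ) {μ ν : Measure X}
    [IsFiniteMeasure μ] [IsFiniteMeasure ν] (hμ : Integrable f μ) (hν : Integrable f ν) :
    ∫ᵛ t, f t ∂•(r • (μ.toSignedMeasure - ν.toSignedMeasure))
      = r * (∫ t, f t ∂μ - ∫ t, f t ∂ν) := by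
  have hflip : (lsmul ℝ ℝ : ℝ →L[ℝ] ℝ →L[ℝ] ℝ) = (lsmul ℝ ℝ : ℝ →L[ℝ] ℝ →L[ℝ] ℝ).flip := by
    ext; simp
  rw [integral_smul_vectorMeasure, integral_sub_vectorMeasure, hflip, integral_toSignedMeasure,
    integral_toSignedMeasure, smul_eq_mul]
  all_goals simpa only [VectorMeasure.Integrable, Measure.variation_toSignedMeasure]

variable {H : Type*} [NormedAddCommGroup H] [InnerProductSpace ℂ H] [CompleteSpace H]

/-- The matrix element `⟨φ, f(T) ψ⟩` of the continuous functional calculus of `T`. -/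
noncomputable def cfcElement (T : H →L[ℂ] H) (φ ψ : H) (f : C(ℝ, ℝ)) : ℂ :=
  inner ℂ φ (cfc f T ψ)

theorem integral_mixedSpectralMeasure (T : H →L[ℂ] H) (φ ψ : H) {f : C(ℝ, ℝ)}
    (hf : HasCompactSupport f) :
    ∫ᵛ t, f t ∂•(mixedSpectralMeasure T φ ψ) = cfcElement T φ ψ f := by
  have hint (ξ : H) : Integrable f (spectralMeasure T ξ) :=
    f.continuous.integrable_of_hasCompactSupport hf
  rw [integral_complexMeasure _ (f.continuous.integrable_of_hasCompactSupport hf)]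
  refine Eq.trans ?_ (mixedSpectralMeasure_spec T φ ψ ⟨f, hf⟩)
  congr 3
  all_goals exact integral_smul_toSignedMeasure_sub _ (hint _) (hint _)

theorem variation_mixedSpectralMeasure (T : H →L[ℂ] H) (φ ψ : H) {U : Set ℝ} (hU : IsOpen U) :
    (mixedSpectralMeasure T φ ψ).variation U = testVariation U (cfcElement T φ ψ) :=
  (variation_eq_testVariation _ hU).trans <|
    testVariation_congr fun _ hf => integral_mixedSpectralMeasure T φ ψ hf

end ComplexMeasure

/-! ### Functions of a Hermitian matrix -/

section HermitianMatrix

open Matrix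

variable {ι : Type*} [Fintype ι] [DecidableEq ι] {A : Matrix ι ι ℂ}

theorem eigenvectorUnitary_conj_diagonal_apply (hA : A.IsHermitian) (g : ι → ℂ) (x y : ι) :
    ((hA.eigenvectorUnitary : Matrix ι ι ℂ) * diagonal g *
      star (hA.eigenvectorUnitary : Matrix ι ι ℂ)) x y
      = ∑ k, g k * (hA.eigenvectorBasis k x * star (hA.eigenvectorBasis k y)) := by
  rw [mul_apply]
  simp only [mul_diagonal, star_apply, IsHermitian.eigenvectorUnitary_apply]
  exact Finset.sum_congr rfl fun k _ => by ring

theorem cfc_apply_eq_sum (hA : A.IsHermitian) (f : ℝ → ℝ) (x y : ι) :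
    cfc f A x y = ∑ k, f (hA.eigenvalues k) *
      (hA.eigenvectorBasis k x * star (hA.eigenvectorBasis k y)) := by
  rw [hA.cfc_eq, IsHermitian.cfc, Unitary.conjStarAlgAut_apply]
  exact eigenvectorUnitary_conj_diagonal_apply hA _ x y

theorem inv_sub_smul_one_apply_eq_sum (hA : A.IsHermitian) {z : ℂ}
    (hz : ∀ k, (hA.eigenvalues k : ℂ) ≠ z) (x y : ι) :
    (A - z • (1 : Matrix ι ι ℂ))⁻¹ x y = ∑ k, ((hA.eigenvalues k : ℂ) - z)⁻¹ *
      (hA.eigenvectorBasis k x * star (hA.eigenvectorBasis k y)) := by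
  rw [← eigenvectorUnitary_conj_diagonal_apply]
  refine congrArg (fun B : Matrix ι ι ℂ => B x y) (inv_eq_right_inv ?_)
  set V : Matrix ι ι ℂ := (hA.eigenvectorUnitary : Matrix ι ι ℂ)
  have hV : star V * V = 1 := Unitary.coe_star_mul_self _
  have hAV : (A - z • (1 : Matrix ι ι ℂ)) * V
      = V * diagonal fun k => (hA.eigenvalues k : ℂ) - z := by
    have hA' : A = V * diagonal (fun k => (hA.eigenvalues k : ℂ)) * star V :=
      hA.spectral_theorem
    have hz' : diagonal (fun _ : ι => z) = z • 1 := (smul_one_eq_diagonal z).symm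
    rw [← diagonal_sub, Matrix.mul_sub, hz', Matrix.sub_mul]
    nth_rw 1 [hA']
    rw [Matrix.mul_assoc, hV, Matrix.mul_one, Matrix.mul_smul, Matrix.smul_mul, Matrix.mul_one,
      Matrix.one_mul]
  have hD : diagonal (fun k => (hA.eigenvalues k : ℂ) - z)
      * diagonal (fun k => ((hA.eigenvalues k : ℂ) - z)⁻¹) = 1 := by
    rw [diagonal_mul_diagonal, ← diagonal_one]
    exact congrArg _ (funext fun k => mul_inv_cancel₀ (sub_ne_zero.2 (hz k)))
  rw [← Matrix.mul_assoc, ← Matrix.mul_assoc, hAV, Matrix.mul_assoc V, hD, Matrix.mul_one]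
  exact Unitary.coe_mul_star_self _

theorem sum_enorm_sq_eigenvectorBasis (hA : A.IsHermitian) (x : ι) :
    ∑ k, ‖hA.eigenvectorBasis k x‖ₑ ^ 2 = 1 := by
  have h := hA.eigenvectorBasis.sum_sq_norm_inner_right (EuclideanSpace.single x (1 : ℂ))
  simp only [EuclideanSpace.inner_single_right, one_mul, RCLike.norm_conj,
    PiLp.norm_single, norm_one, one_pow] at h
  simp only [← ofReal_norm, ← ENNReal.ofReal_pow (norm_nonneg _)]
  rw [← ENNReal.ofReal_sum_of_nonneg fun _ _ => by positivity, h, ENNReal.ofReal_one]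

open scoped Matrix.Norms.L2Operator in
theorem continuous_cfc_matrix {α : Type*} [TopologicalSpace α] {A : α → Matrix ι ι ℂ}
    (hA : Continuous A) (hH : ∀ a, (A a).IsHermitian) {f : ℝ → ℝ} (hf : Continuous f) :
    Continuous fun a => cfc f (A a) :=
  hA.cfc_of_mem_nhdsSet f (s := Set.univ) Filter.univ_mem hH hf.continuousOn

end HermitianMatrix

/-! ### Spectral averaging for rank-one perturbations -/

section Cauchy

theorem lintegral_cauchyPDF_le_one (t : ℝ) (ε : ℝ≥0) : ∫⁻ E, cauchyPDF t ε E ≤ 1 := by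
  rcases eq_or_ne ε 0 with rfl | hε
  · simp
  · exact (lintegral_cauchyPDF_eq_one t hε).le

theorem cauchyPDF_comm (t : ℝ) (ε : ℝ≥0) (E : ℝ) : cauchyPDF t ε E = cauchyPDF E ε t := by
  simp only [cauchyPDF_def, cauchyPDFReal_def, ← neg_sub t E, neg_sq]

theorem measurable_cauchyPDF_uncurry (ε : ℝ≥0) :
    Measurable (Function.uncurry fun t E : ℝ => cauchyPDF t ε E) := by
  simp only [cauchyPDF, cauchyPDFReal, Function.uncurry_def]
  fun_prop

theorem ofReal_im_inv_sub_eq_cauchyPDF (v : ℝ) (w : ℂ) :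
    ENNReal.ofReal (Real.pi⁻¹ * (((v : ℂ) - w)⁻¹).im) = cauchyPDF w.re w.im.toNNReal v := by
  have him : (((v : ℂ) - w)⁻¹).im = w.im * ((v - w.re) ^ 2 + w.im ^ 2)⁻¹ := by
    rw [Complex.inv_im, Complex.normSq_apply]
    simp [div_eq_mul_inv, sq]
  rw [him, ← mul_assoc, cauchyPDF_def, cauchyPDFReal_def]
  rcases le_total 0 w.im with hw | hw
  · rw [Real.coe_toNNReal _ hw]
  · rw [Real.toNNReal_of_nonpos hw, ENNReal.ofReal_of_nonpos]
    · simp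
    · exact mul_nonpos_of_nonpos_of_nonneg
        (mul_nonpos_of_nonneg_of_nonpos (by positivity) hw) (by positivity)

theorem setLIntegral_cauchyPDF (t : ℝ) {ε : ℝ≥0} (hε : ε ≠ 0) {U : Set ℝ} (hU : MeasurableSet U) :
    ∫⁻ E in U, cauchyPDF t ε E = ∫⁻ u, U.indicator 1 (t + ε * u) * cauchyPDF 0 1 u := by
  have hε' : (ε : ℝ) ≠ 0 := by exact_mod_cast hε
  have hm : Measurable (U.indicator fun E => cauchyPDF t ε E) :=
    (measurable_cauchyPDF t ε).indicator hU
  have hm' : Measurable fun E => U.indicator (fun E => cauchyPDF t ε E) (t + E) :=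
    hm.comp (measurable_const_add t)
  have hm'' : Measurable fun u => U.indicator (fun E => cauchyPDF t ε E) (t + ε * u) :=
    hm'.comp (measurable_const_mul (ε : ℝ))
  calc ∫⁻ E in U, cauchyPDF t ε E
      = ∫⁻ E, U.indicator (fun E => cauchyPDF t ε E) (t + E) := by
        rw [lintegral_add_left_eq_self (μ := volume), lintegral_indicator hU]
    _ = ENNReal.ofReal |(ε : ℝ)| * ∫⁻ u, U.indicator (fun E => cauchyPDF t ε E) (t + ε * u) := by
        nth_rw 1 [← Real.smul_map_volume_mul_left hε']
        rw [lintegral_smul_measure, lintegral_map hm' (measurable_const_mul _), smul_eq_mul]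
    _ = ∫⁻ u, U.indicator 1 (t + ε * u) * cauchyPDF 0 1 u := by
        rw [← lintegral_const_mul _ hm'']
        refine lintegral_congr fun u => ?_
        by_cases hu : t + ε * u ∈ U
        · simp only [Set.indicator_of_mem hu, Pi.one_apply, one_mul, cauchyPDF_def,
            cauchyPDFReal_def]
          rw [← ENNReal.ofReal_mul (abs_nonneg _), NNReal.abs_eq]
          simp only [add_sub_cancel_left, sub_zero, NNReal.coe_one]
          congr 1
          field_simp
        · simp [Set.indicator_of_notMem hu]

theorem one_le_liminf_setLIntegral_cauchyPDF {U : Set ℝ} (hU : IsOpen U) {t : ℝ} (ht : t ∈ U)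
    {ε : ℕ → ℝ≥0} (hε : ∀ n, ε n ≠ 0) (hlim : Tendsto ε atTop (𝓝 0)) :
    1 ≤ liminf (fun n => ∫⁻ E in U, cauchyPDF t (ε n) E) atTop := by
  simp only [fun n => setLIntegral_cauchyPDF t (hε n) hU.measurableSet]
  refine le_trans ?_ (lintegral_liminf_le fun n => ?_)
  · rw [← lintegral_cauchyPDF_eq_one 0 one_ne_zero]
    refine lintegral_mono fun u => le_liminf_of_le (by isBoundedDefault) ?_
    have hc : Tendsto (fun n => t + (ε n : ℝ) * u) atTop (𝓝 t) := by
      simpa using ((NNReal.tendsto_coe.2 hlim).mul_const u).const_add t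
    filter_upwards [hc.eventually (hU.mem_nhds ht)] with n hn
    simp [Set.indicator_of_mem hn]
  · exact ((measurable_one.indicator hU.measurableSet).comp (by fun_prop)).mul
      (measurable_cauchyPDF 0 1)

theorem le_volume_of_lintegral_cauchyPDF_le_one {ν : Measure ℝ} [SFinite ν]
    (h : ∀ E, ∀ ε ≠ 0, ∫⁻ t, cauchyPDF E ε t ∂ν ≤ 1) : ν ≤ volume := by
  refine Measure.le_intro fun s _ _ => ?_
  rw [s.measure_eq_iInf_isOpen volume]
  refine le_iInf₂ fun U hsU => le_iInf fun hU => (measure_mono hsU).trans ?_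
  let ε : ℕ → ℝ≥0 := fun n => 1 / ((n : ℝ≥0) + 1)
  have hε : ∀ n, ε n ≠ 0 := fun n => by positivity
  calc ν U
      = ∫⁻ t, U.indicator 1 t ∂ν := (lintegral_indicator_one hU.measurableSet).symm
    _ ≤ ∫⁻ t, (liminf (fun n => ∫⁻ E in U, cauchyPDF t (ε n) E) atTop) ∂ν :=
        lintegral_mono <| Set.indicator_le fun t ht =>
          one_le_liminf_setLIntegral_cauchyPDF hU ht hε tendsto_one_div_add_atTop_nhds_zero_nat
    _ ≤ liminf (fun n => ∫⁻ t, (∫⁻ E in U, cauchyPDF t (ε n) E) ∂ν) atTop :=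
        lintegral_liminf_le fun n => (measurable_cauchyPDF_uncurry (ε n)).lintegral_prod_right'
    _ ≤ liminf (fun _ : ℕ => volume U) atTop := by
        refine liminf_le_liminf (Eventually.of_forall fun n => ?_)
        rw [lintegral_lintegral_swap (measurable_cauchyPDF_uncurry (ε n)).aemeasurable]
        simp only [cauchyPDF_comm _ (ε n)]
        exact (lintegral_mono fun E => h E _ (hε n)).trans (setLIntegral_one U).le
    _ = volume U := by simp

end Cauchy

section SpectralAveraging

open Matrix

variable {ι : Type*} [Fintype ι] [DecidableEq ι] {A : Matrix ι ι ℂ}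

/-- The spectral measure `B ↦ ⟨e_x, χ_B(A) e_x⟩` of a Hermitian matrix `A` at the basis vector
`e_x`. -/
noncomputable def matrixSpectralMeasure (hA : A.IsHermitian) (x : ι) : Measure ℝ :=
  ∑ k, ‖hA.eigenvectorBasis k x‖ₑ ^ 2 • Measure.dirac (hA.eigenvalues k)

theorem lintegral_matrixSpectralMeasure (hA : A.IsHermitian) (x : ι) (f : ℝ → ℝ≥0∞) :
    ∫⁻ t, f t ∂matrixSpectralMeasure hA x
      = ∑ k, ‖hA.eigenvectorBasis k x‖ₑ ^ 2 * f (hA.eigenvalues k) := by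
  simp [matrixSpectralMeasure, lintegral_finsetSum_measure]

instance isProbabilityMeasure_matrixSpectralMeasure (hA : A.IsHermitian) (x : ι) :
    IsProbabilityMeasure (matrixSpectralMeasure hA x) :=
  ⟨by rw [← lintegral_one, lintegral_matrixSpectralMeasure]; simp [sum_enorm_sq_eigenvectorBasis]⟩

theorem lintegral_ofReal_matrixSpectralMeasure (hA : A.IsHermitian) (x : ι) {f : ℝ → ℝ}
    (hf : ∀ t, 0 ≤ f t) :
    ∫⁻ t, ENNReal.ofReal (f t) ∂matrixSpectralMeasure hA x = ENNReal.ofReal (cfc f A x x).re := by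
  have hre : (cfc f A x x).re = ∑ k, ‖hA.eigenvectorBasis k x‖ ^ 2 * f (hA.eigenvalues k) := by
    rw [cfc_apply_eq_sum hA, Complex.re_sum]
    refine Finset.sum_congr rfl fun k _ => ?_
    rw [← starRingEnd_apply, Complex.mul_conj', Complex.re_ofReal_mul, mul_comm]
    norm_cast
  rw [hre, lintegral_matrixSpectralMeasure,
    ENNReal.ofReal_sum_of_nonneg fun k _ => mul_nonneg (by positivity) (hf _)]
  refine Finset.sum_congr rfl fun k _ => ?_
  rw [ENNReal.ofReal_mul (by positivity), ENNReal.ofReal_pow (norm_nonneg _), ofReal_norm]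

theorem measurable_matrixSpectralMeasure {α : Type*} [TopologicalSpace α] [MeasurableSpace α]
    [OpensMeasurableSpace α] {A : α → Matrix ι ι ℂ} (hA : Continuous A)
    (hH : ∀ a, (A a).IsHermitian) (x : ι) :
    Measurable fun a => matrixSpectralMeasure (hH a) x := by
  refine Measurable.measure_of_isPiSystem_of_isProbabilityMeasure
    ((BorelSpace.measurable_eq (α := ℝ)).trans borel_eq_generateFrom_isClosed)
    isPiSystem_isClosed fun F hF => ?_
  have hδ : ∀ n : ℕ, (0 : ℝ) < 1 / ((n : ℝ) + 1) := fun n => by positivity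
  refine measurable_of_tendsto_metrizable (fun n => ?_) (tendsto_pi_nhds.2 fun a =>
    tendsto_lintegral_thickenedIndicator_of_isClosed (matrixSpectralMeasure (hH a) x) hF hδ
      tendsto_one_div_add_atTop_nhds_zero_nat)
  let g : ℝ → ℝ := fun t => thickenedIndicator (hδ n) F t
  have hcfc (a : α) : ∫⁻ t, (thickenedIndicator (hδ n) F t : ℝ≥0∞) ∂matrixSpectralMeasure (hH a) x
      = ENNReal.ofReal (cfc g (A a) x x).re := by
    rw [← lintegral_ofReal_matrixSpectralMeasure (hH a) x fun t => NNReal.coe_nonneg _]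
    simp only [ENNReal.ofReal_coe_nnreal]
  have hg : Continuous g := by fun_prop
  simp only [hcfc]
  exact (Complex.measurable_re.comp
    ((continuous_cfc_matrix hA hH hg).matrix_elem x x).measurable).ennreal_ofReal

theorem lintegral_cauchyPDF_matrixSpectralMeasure (hA : A.IsHermitian) (x : ι) (E : ℝ) {ε : ℝ≥0}
    (hε : ε ≠ 0) :
    ∫⁻ t, cauchyPDF E ε t ∂matrixSpectralMeasure hA x = ENNReal.ofReal (Real.pi⁻¹ *
      ((A - ((E : ℂ) + (ε : ℝ) * Complex.I) • (1 : Matrix ι ι ℂ))⁻¹ x x).im) := by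
  set z : ℂ := (E : ℂ) + (ε : ℝ) * Complex.I
  have hzim : z.im = ε := by simp [z]
  have hcauchy (t : ℝ) :
      cauchyPDF E ε t = ENNReal.ofReal (Real.pi⁻¹ * (((t : ℂ) - z)⁻¹).im) := by
    rw [ofReal_im_inv_sub_eq_cauchyPDF, hzim, Real.toNNReal_coe]
    simp [z]
  have hz (k) : (hA.eigenvalues k : ℂ) ≠ z := fun h =>
    hε (by simpa [hzim] using (congrArg Complex.im h).symm)
  have hnonneg (t : ℝ) : 0 ≤ Real.pi⁻¹ * (((t : ℂ) - z)⁻¹).im := by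
    have : 0 ≤ -((t : ℂ) - z).im := by simp [hzim]
    rw [Complex.inv_im]
    exact mul_nonneg (by positivity) (div_nonneg this (Complex.normSq_nonneg _))
  simp only [hcauchy]
  have hterm (k) : Real.pi⁻¹ * (((hA.eigenvalues k : ℂ) - z)⁻¹ *
      (hA.eigenvectorBasis k x * star (hA.eigenvectorBasis k x))).im
      = ‖hA.eigenvectorBasis k x‖ ^ 2 *
        (Real.pi⁻¹ * (((hA.eigenvalues k : ℂ) - z)⁻¹).im) := by
    rw [← starRingEnd_apply, Complex.mul_conj', ← Complex.ofReal_pow, Complex.im_mul_ofReal]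
    ring
  rw [lintegral_matrixSpectralMeasure, inv_sub_smul_one_apply_eq_sum hA hz, Complex.im_sum,
    Finset.mul_sum, Finset.sum_congr rfl fun k _ => hterm k,
    ENNReal.ofReal_sum_of_nonneg fun k _ => mul_nonneg (by positivity) (hnonneg _)]
  refine Finset.sum_congr rfl fun k _ => ?_
  rw [← ofReal_norm, ← ENNReal.ofReal_pow (norm_nonneg _), ← ENNReal.ofReal_mul (sq_nonneg _)]

omit [Fintype ι] in
theorem isHermitian_add_single {K : Matrix ι ι ℂ} (hK : K.IsHermitian) (x : ι) (v : ℝ) :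
    (K + single x x (v : ℂ)).IsHermitian :=
  hK.add (by rw [IsHermitian, conjTranspose_single]; simp)

omit [Fintype ι] in
theorem continuous_add_single (A : Matrix ι ι ℂ) (x : ι) :
    Continuous fun v : ℝ => A + single x x (v : ℂ) :=
  continuous_matrix fun i j => by
    simp only [Matrix.add_apply, single_apply]
    split_ifs <;> fun_prop

theorem adjugate_add_single_apply_self (A : Matrix ι ι ℂ) (x : ι) (c : ℂ) :
    (A + single x x c).adjugate x x = A.adjugate x x := by
  simp only [adjugate_apply]
  congr 1
  ext i j
  rcases eq_or_ne i x with rfl | hi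
  · simp
  · simp [hi, single, hi.symm]

theorem det_add_single (A : Matrix ι ι ℂ) (x : ι) (c : ℂ) :
    (A + single x x c).det = A.det + c * A.adjugate x x := by
  have h : A + single x x c = A.updateRow x (A x + c • Pi.single x 1) := by
    ext i j
    rcases eq_or_ne i x with rfl | hi
    · simp [single, Pi.single_apply, eq_comm]
    · simp [hi, single, hi.symm]
  rw [h, det_updateRow_add, det_updateRow_smul, updateRow_eq_self, adjugate_apply]

theorem inv_add_single_apply_self (A : Matrix ι ι ℂ) (x : ι) (c : ℂ) :
    (A + single x x c)⁻¹ x x = A.adjugate x x / (A.det + c * A.adjugate x x) := by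
  rw [inv_def, Matrix.smul_apply, adjugate_add_single_apply_self, det_add_single,
    Ring.inverse_eq_inv', smul_eq_mul, div_eq_inv_mul]

theorem lintegral_im_inv_add_single_le_one (A : Matrix ι ι ℂ) (x : ι) :
    ∫⁻ v : ℝ, ENNReal.ofReal (Real.pi⁻¹ * ((A + single x x (v : ℂ))⁻¹ x x).im) ≤ 1 := by
  by_cases h0 : A.adjugate x x = 0
  · simp [inv_add_single_apply_self, h0]
  have hinv (v : ℝ) : (A + single x x (v : ℂ))⁻¹ x x
      = ((v : ℂ) - -(A.det / A.adjugate x x))⁻¹ := by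
    rw [inv_add_single_apply_self, sub_neg_eq_add, add_comm A.det, ← inv_div, add_div,
      mul_div_cancel_right₀ _ h0]
  simp only [hinv, ofReal_im_inv_sub_eq_cauchyPDF]
  exact lintegral_cauchyPDF_le_one _ _

variable {K : Matrix ι ι ℂ} (hK : K.IsHermitian) (x : ι)

/-- The spectral measures at `e_x` of the rank-one perturbations `K + v|e_x⟩⟨e_x|` of `K`, as a
kernel in `v`. -/
noncomputable def rankOneKernel : Kernel ℝ ℝ where
  toFun v := matrixSpectralMeasure (isHermitian_add_single hK x v) x
  measurable' :=
    measurable_matrixSpectralMeasure (continuous_add_single K x) (isHermitian_add_single hK x) x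

instance : IsMarkovKernel (rankOneKernel hK x) :=
  ⟨fun v => isProbabilityMeasure_matrixSpectralMeasure (isHermitian_add_single hK x v) x⟩

theorem bind_rankOneKernel_le_volume : volume.bind (rankOneKernel hK x) ≤ volume := by
  refine le_volume_of_lintegral_cauchyPDF_le_one fun E ε hε => ?_
  rw [Measure.lintegral_bind (rankOneKernel hK x).aemeasurable
    (measurable_cauchyPDF E ε).aemeasurable]
  refine le_of_eq_of_le (lintegral_congr fun v => ?_) (lintegral_im_inv_add_single_le_one
    (K - ((E : ℂ) + (ε : ℝ) * Complex.I) • (1 : Matrix ι ι ℂ)) x)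
  rw [← add_sub_right_comm]
  exact lintegral_cauchyPDF_matrixSpectralMeasure _ x E hε

theorem lintegral_lintegral_rankOneKernel_le {f : ℝ → ℝ≥0∞} (hf : Measurable f) :
    ∫⁻ v, ∫⁻ t, f t ∂rankOneKernel hK x v ≤ ∫⁻ t, f t := by
  rw [← Measure.lintegral_bind (rankOneKernel hK x).aemeasurable hf.aemeasurable]
  exact lintegral_mono' (bind_rankOneKernel_le_volume hK x) le_rfl

end SpectralAveraging

/-! ### Fractional moments control the eigenfunction correlator -/

theorem rpow_sum_mul_le {ι : Type*} (t : Finset ι) {p : ℝ} (hp : 1 ≤ p) (a b : ι → ℝ≥0∞)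
    (hb : ∑ i ∈ t, b i ^ 2 ≤ 1) :
    (∑ i ∈ t, a i * b i) ^ p ≤ ∑ i ∈ t, a i ^ p * b i ^ (2 - p) := by
  have hp0 : 0 < p := one_pos.trans_le hp
  have hbtop (i) (hi : i ∈ t) : b i ≠ ⊤ := by
    have := (Finset.single_le_sum (f := fun i => b i ^ 2) (fun _ _ => zero_le) hi).trans hb
    rintro h
    simp [h] at this
  calc (∑ i ∈ t, a i * b i) ^ p
      = (∑ i ∈ t, b i ^ 2 * (a i / b i)) ^ p := by
        congr 1
        refine Finset.sum_congr rfl fun i hi => ?_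
        rcases eq_or_ne (b i) 0 with h | h
        · simp [h]
        · rw [sq, mul_assoc, ENNReal.mul_div_cancel h (hbtop i hi), mul_comm]
    _ ≤ ((∑ i ∈ t, b i ^ 2) ^ (1 - p⁻¹) * (∑ i ∈ t, b i ^ 2 * (a i / b i) ^ p) ^ p⁻¹) ^ p := by
        gcongr
        exact ENNReal.inner_le_weight_mul_Lp_of_nonneg t hp _ _
    _ ≤ (1 * (∑ i ∈ t, b i ^ 2 * (a i / b i) ^ p) ^ p⁻¹) ^ p := by
        gcongr
        exact ENNReal.rpow_le_one hb (sub_nonneg.2 (inv_le_one_of_one_le₀ hp))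
    _ = ∑ i ∈ t, b i ^ 2 * (a i / b i) ^ p := by
        rw [one_mul, ENNReal.rpow_inv_rpow hp0.ne']
    _ ≤ ∑ i ∈ t, a i ^ p * b i ^ (2 - p) := by
        refine Finset.sum_le_sum fun i hi => ?_
        rcases eq_or_ne (b i) 0 with h | h
        · simp [h]
        · rw [ENNReal.div_rpow_of_nonneg _ _ hp0.le, ENNReal.rpow_sub _ _ h (hbtop i hi),
            ENNReal.rpow_ofNat, div_eq_mul_inv, div_eq_mul_inv, mul_left_comm]

section EigenfunctionCorrelator

open Matrix

variable {ι : Type*} [Fintype ι] [DecidableEq ι] {A : Matrix ι ι ℂ}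

/-- The Green function `⟨e_x, (A - E)⁻¹ e_y⟩` of a matrix `A` at a real energy `E`. -/
noncomputable def matrixGreen (A : Matrix ι ι ℂ) (x y : ι) (E : ℝ) : ℂ :=
  (A - (E : ℂ) • (1 : Matrix ι ι ℂ))⁻¹ x y

theorem measurable_matrixGreen {α : Type*} [TopologicalSpace α] [MeasurableSpace α]
    [OpensMeasurableSpace α] {A : α → Matrix ι ι ℂ} (hA : Continuous A) (x y : ι) {E : α → ℝ}
    (hE : Continuous E) : Measurable fun a => matrixGreen (A a) x y (E a) := by
  have hcont : Continuous fun a => A a - (E a : ℂ) • (1 : Matrix ι ι ℂ) := by fun_prop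
  simp only [matrixGreen, inv_def, Matrix.smul_apply, Ring.inverse_eq_inv', smul_eq_mul]
  exact hcont.matrix_det.measurable.inv.mul (hcont.matrix_adjugate.matrix_elem x y).measurable

theorem matrixGreen_comm (hA : A.IsHermitian) (x y : ι) (E : ℝ) :
    ‖matrixGreen A x y E‖ₑ = ‖matrixGreen A y x E‖ₑ := by
  have h : ((A - (E : ℂ) • (1 : Matrix ι ι ℂ))⁻¹).IsHermitian :=
    (hA.sub (isHermitian_one.smul (Complex.conj_ofReal E))).inv
  rw [matrixGreen, ← h.apply x y, ← ofReal_norm, norm_star, ofReal_norm, matrixGreen]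

theorem ae_det_sub_smul_one_ne_zero (A : Matrix ι ι ℂ) :
    ∀ᵐ E : ℝ, (A - (E : ℂ) • (1 : Matrix ι ι ℂ)).det ≠ 0 := by
  have hfin := A.finite_spectrum.preimage (f := fun E : ℝ => (E : ℂ))
    Complex.ofReal_injective.injOn
  filter_upwards [compl_mem_ae_iff.2 (hfin.measure_zero volume)] with E hE
  rw [Set.mem_compl_iff, Set.mem_preimage, spectrum.notMem_iff, isUnit_iff_isUnit_det,
    isUnit_iff_ne_zero, ← neg_sub, det_neg, Algebra.algebraMap_eq_smul_one] at hE
  exact right_ne_zero_of_mul hE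

theorem apply_eq_inv_mul_of_add_single_mulVec_eq_zero (hA : A.det ≠ 0) {x : ι} {c : ℂ} {u : ι → ℂ}
    (hu : (A + single x x c) *ᵥ u = 0) (y : ι) : u y = -c * A⁻¹ y x * u x := by
  have hAu : A *ᵥ u = -(c * u x) • Pi.single x 1 := by
    rw [add_mulVec, single_mulVec] at hu
    rw [eq_neg_of_add_eq_zero_left hu]
    ext i
    rcases eq_or_ne i x with rfl | hi <;> simp [*]
  have := congrFun (congrArg (A⁻¹ *ᵥ ·) hAu) y
  simp only [mulVec_mulVec, nonsing_inv_mul _ (isUnit_iff_ne_zero.2 hA), one_mulVec, mulVec_smul,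
    mulVec_single_one, Pi.smul_apply, col_apply, smul_eq_mul] at this
  rw [this]
  ring

/-- The eigenfunction correlator `∑_{λ ∈ U} |ψ_λ(x)| |ψ_λ(y)|` of a Hermitian matrix, over its
orthonormal eigenvectors `ψ_λ` with eigenvalue `λ` in `U`. -/
noncomputable def eigenCorrelator (hA : A.IsHermitian) (U : Set ℝ) (x y : ι) : ℝ≥0∞ :=
  ∑ k, U.indicator (fun _ => ‖hA.eigenvectorBasis k x‖ₑ * ‖hA.eigenvectorBasis k y‖ₑ)
    (hA.eigenvalues k)

theorem testVariation_cfc_le_eigenCorrelator (hA : A.IsHermitian) (U : Set ℝ) (x y : ι) :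
    testVariation U (fun f => cfc f A x y) ≤ eigenCorrelator hA U x y := by
  refine testVariation_le fun n f hf => ?_
  set c : ι → ℝ≥0∞ := fun k => ‖hA.eigenvectorBasis k x‖ₑ * ‖hA.eigenvectorBasis k y‖ₑ
  have hterm (i k) : ‖(f i (hA.eigenvalues k) : ℂ) * (hA.eigenvectorBasis k x *
      star (hA.eigenvectorBasis k y))‖ₑ = ‖f i (hA.eigenvalues k)‖ₑ * c k := by
    simp only [c, ← ofReal_norm, norm_mul, norm_star, Complex.norm_real,
      ENNReal.ofReal_mul (norm_nonneg _)]
  calc ∑ i, ‖cfc (f i) A x y‖ₑ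
      ≤ ∑ i, ∑ k, ‖f i (hA.eigenvalues k)‖ₑ * c k := by
        refine Finset.sum_le_sum fun i _ => ?_
        rw [cfc_apply_eq_sum hA]
        exact (enorm_sum_le _ _).trans_eq (Finset.sum_congr rfl fun k _ => hterm i k)
    _ = ∑ k, (∑ i, ‖f i (hA.eigenvalues k)‖ₑ) * c k := by
        rw [Finset.sum_comm]
        simp only [Finset.sum_mul]
    _ ≤ ∑ k, U.indicator 1 (hA.eigenvalues k) * c k := by
        gcongr with k
        exact hf.2 _
    _ = eigenCorrelator hA U x y := by
        refine Finset.sum_congr rfl fun k _ => ?_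
        by_cases hk : hA.eigenvalues k ∈ U <;> simp [hk, c]

theorem eigenCorrelator_rpow_le_sum (hA : A.IsHermitian) (U : Set ℝ) (x y : ι) {s : ℝ}
    (hs1 : s ≤ 1) :
    eigenCorrelator hA U x y ^ (2 - s) ≤ ∑ k, U.indicator (fun _ =>
      ‖hA.eigenvectorBasis k x‖ₑ ^ (2 - s) * ‖hA.eigenvectorBasis k y‖ₑ ^ s)
        (hA.eigenvalues k) := by
  classical
  simp only [eigenCorrelator, Set.indicator_apply, ← Finset.sum_filter]
  refine (rpow_sum_mul_le _ (by linarith) _ _ ?_).trans_eq (by simp only [sub_sub_cancel])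
  exact (Finset.sum_le_sum_of_subset (Finset.filter_subset _ _)).trans_eq
    (sum_enorm_sq_eigenvectorBasis hA y)

theorem ae_matrixSpectralMeasure_iff (hA : A.IsHermitian) (x : ι) {p : ℝ → Prop} :
    (∀ᵐ t ∂matrixSpectralMeasure hA x, p t)
      ↔ ∀ k, hA.eigenvectorBasis k x ≠ 0 → p (hA.eigenvalues k) := by
  simp only [ae_iff, matrixSpectralMeasure, Measure.coe_finsetSum, Finset.sum_apply,
    Finset.sum_eq_zero_iff, Finset.mem_univ, true_imp_iff]
  refine forall_congr' fun k => ?_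
  rw [Measure.smul_apply, smul_eq_mul, mul_eq_zero, Measure.dirac_apply]
  simp [or_iff_not_imp_left]

end EigenfunctionCorrelator

section FractionalMoments

open Matrix

variable {ι : Type*} [Fintype ι] [DecidableEq ι] {A : Matrix ι ι ℂ}

theorem eigenvectorBasis_apply_eq_mul_matrixGreen (hA : A.IsHermitian) {x : ι} {c : ℂ} {k : ι}
    (hdet : (A + single x x c - (hA.eigenvalues k : ℂ) • (1 : Matrix ι ι ℂ)).det ≠ 0) (y : ι) :
    hA.eigenvectorBasis k y = c * matrixGreen (A + single x x c) y x (hA.eigenvalues k) *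
      hA.eigenvectorBasis k x := by
  have hker : (A + single x x c - (hA.eigenvalues k : ℂ) • (1 : Matrix ι ι ℂ) + single x x (-c)) *ᵥ
      ⇑(hA.eigenvectorBasis k) = 0 := by
    rw [add_sub_right_comm, add_assoc, ← single_add, add_neg_cancel, single_zero, add_zero,
      sub_mulVec, smul_mulVec, one_mulVec, hA.mulVec_eigenvectorBasis k]
    exact sub_self _
  rw [apply_eq_inv_mul_of_add_single_mulVec_eq_zero hdet hker y, neg_neg, matrixGreen]

theorem eigenCorrelator_rpow_le_lintegral {s : ℝ} (hs0 : 0 ≤ s) (hs1 : s ≤ 1)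
    (hA : A.IsHermitian) {U : Set ℝ} (hU : MeasurableSet U) (x y : ι) {c : ℝ}
    (hdet : ∀ᵐ E : ℝ ∂matrixSpectralMeasure hA x,
      (A + single x x (c : ℂ) - (E : ℂ) • (1 : Matrix ι ι ℂ)).det ≠ 0) :
    eigenCorrelator hA U x y ^ (2 - s) ≤ ∫⁻ E in U,
      (‖c‖ₑ * ‖matrixGreen (A + single x x (c : ℂ)) x y E‖ₑ) ^ s ∂matrixSpectralMeasure hA x := by
  rw [ae_matrixSpectralMeasure_iff] at hdet
  refine (eigenCorrelator_rpow_le_sum hA U x y hs1).trans ?_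
  rw [← lintegral_indicator hU, lintegral_matrixSpectralMeasure]
  refine Finset.sum_le_sum fun k _ => ?_
  by_cases hk : hA.eigenvalues k ∈ U
  swap
  · simp [hk]
  rcases eq_or_ne (hA.eigenvectorBasis k x) 0 with hx | hx
  · simp [hk, hx, ENNReal.zero_rpow_of_pos (by linarith : 0 < 2 - s)]
  have hx' : ‖hA.eigenvectorBasis k x‖ₑ ≠ 0 := enorm_ne_zero.2 hx
  have hc : IsSelfAdjoint (single x x (c : ℂ)) := by simp [IsSelfAdjoint, star_eq_conjTranspose]
  simp only [Set.indicator_of_mem hk]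
  rw [eigenvectorBasis_apply_eq_mul_matrixGreen hA (hdet k hx) y, enorm_mul, enorm_mul,
    matrixGreen_comm (hA.add hc) y x, ENNReal.mul_rpow_of_nonneg _ _ hs0, mul_left_comm,
    ← ENNReal.rpow_add _ _ hx' enorm_ne_top, sub_add_cancel, ENNReal.rpow_ofNat, mul_comm,
    ← ofReal_norm (c : ℂ), Complex.norm_real, ofReal_norm]

variable {K : Matrix ι ι ℂ} (hK : K.IsHermitian)

theorem ae_ae_rankOneKernel (x : ι) {p : ℝ → Prop} (hp : ∀ᵐ E, p E) :
    ∀ᵐ v, ∀ᵐ E ∂rankOneKernel hK x v, p E :=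
  Measure.ae_ae_of_ae_bind (rankOneKernel hK x).aemeasurable
    ((Measure.absolutelyContinuous_of_le (bind_rankOneKernel_le_volume hK x)).ae_le hp)

variable {s : ℝ} (hs0 : 0 ≤ s) (hs1 : s ≤ 1) {U : Set ℝ} (hU : MeasurableSet U) (x y : ι)
  {κ : Measure ℝ} [IsProbabilityMeasure κ] {M : ℝ} {N : ℝ≥0} (hM : ∀ᵐ v ∂κ, |v| ≤ M)
  (hN : κ ≤ N • volume)

include hs0 hs1 hU hM hN

omit [IsProbabilityMeasure κ] in
theorem lintegral_eigenCorrelator_rpow_le_of_abs_le {w : ℝ} (hw : |w| ≤ M) :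
    ∫⁻ v, eigenCorrelator (isHermitian_add_single hK x v) U x y ^ (2 - s) ∂κ
      ≤ N * ENNReal.ofReal (2 * M) ^ s *
        ∫⁻ E in U, ‖matrixGreen (K + single x x (w : ℂ)) x y E‖ₑ ^ s := by
  set f : ℝ → ℝ≥0∞ := U.indicator fun E =>
    (ENNReal.ofReal (2 * M) * ‖matrixGreen (K + single x x (w : ℂ)) x y E‖ₑ) ^ s
  have hf : Measurable f := (((measurable_matrixGreen continuous_const x y
    continuous_id).enorm.const_mul _).pow_const s).indicator hU
  have hac : κ ≪ volume := (Measure.absolutelyContinuous_of_le hN).trans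
    Measure.smul_absolutelyContinuous
  calc ∫⁻ v, eigenCorrelator (isHermitian_add_single hK x v) U x y ^ (2 - s) ∂κ
      ≤ ∫⁻ v, (∫⁻ E, f E ∂rankOneKernel hK x v) ∂κ := by
        refine lintegral_mono_ae ?_
        filter_upwards [hM, hac.ae_le (ae_ae_rankOneKernel hK x
          (ae_det_sub_smul_one_ne_zero (K + single x x (w : ℂ))))] with v hv hdet
        have hvw : K + single x x (w : ℂ)
            = K + single x x (v : ℂ) + single x x ((w - v : ℝ) : ℂ) := by
          rw [add_assoc, ← single_add, Complex.ofReal_sub, add_sub_cancel]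
        have hdist : ‖w - v‖ₑ ≤ ENNReal.ofReal (2 * M) := by
          rw [← ofReal_norm]
          exact ENNReal.ofReal_le_ofReal ((norm_sub_le w v).trans (by simp; linarith))
        rw [hvw] at hdet
        refine (eigenCorrelator_rpow_le_lintegral hs0 hs1 _ hU x y hdet).trans ?_
        rw [← hvw, ← lintegral_indicator hU]
        refine lintegral_mono fun E => Set.indicator_le_indicator ?_
        gcongr
    _ ≤ ∫⁻ v, (∫⁻ E, f E ∂rankOneKernel hK x v) ∂(N • volume) := lintegral_mono' hN le_rfl
    _ = N * ∫⁻ v, ∫⁻ E, f E ∂rankOneKernel hK x v := lintegral_smul_measure _ _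
    _ ≤ N * ∫⁻ E, f E := by gcongr 1; exact lintegral_lintegral_rankOneKernel_le hK x hf
    _ = N * ENNReal.ofReal (2 * M) ^ s *
        ∫⁻ E in U, ‖matrixGreen (K + single x x (w : ℂ)) x y E‖ₑ ^ s := by
        rw [lintegral_indicator hU, mul_assoc,
          ← lintegral_const_mul' (ENNReal.ofReal (2 * M) ^ s) _ (by finiteness)]
        simp only [ENNReal.mul_rpow_of_nonneg _ _ hs0]

theorem lintegral_eigenCorrelator_rpow_le :
    ∫⁻ v, eigenCorrelator (isHermitian_add_single hK x v) U x y ^ (2 - s) ∂κ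
      ≤ N * ENNReal.ofReal (2 * M) ^ s * ∫⁻ w, (∫⁻ E in U,
        ‖matrixGreen (K + single x x (w : ℂ)) x y E‖ₑ ^ s) ∂κ := by
  rw [← lintegral_const_mul' _ _ (by finiteness)]
  conv_lhs => rw [← mul_one (∫⁻ v, _ ∂κ), ← measure_univ (μ := κ), ← lintegral_const]
  refine lintegral_mono_ae ?_
  filter_upwards [hM] with w hw
  exact lintegral_eigenCorrelator_rpow_le_of_abs_le hK hs0 hs1 hU x y hM hN hw

end FractionalMoments

theorem lintegral_le_lintegral_rpow {α : Type*} [MeasurableSpace α] (m : Measure α)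
    [IsProbabilityMeasure m] {p : ℝ} (hp : 1 ≤ p) {f : α → ℝ≥0∞} (hf : AEMeasurable f m) :
    ∫⁻ a, f a ∂m ≤ (∫⁻ a, f a ^ p ∂m) ^ (1 / p) := by
  simpa [eLpNorm'_eq_lintegral_enorm] using
    eLpNorm'_le_eLpNorm'_of_exponent_le one_pos hp m hf.aestronglyMeasurable

section IndependentPotential

open Matrix

variable {ι : Type*} [Fintype ι] [DecidableEq ι] {K : Matrix ι ι ℂ}

/-- The matrix `K + ∑_i W_i |e_i⟩⟨e_i|`, i.e. `K` with an additional potential `W`. -/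
noncomputable def addPotential (K : Matrix ι ι ℂ) (W : ι → ℝ) : Matrix ι ι ℂ :=
  K + diagonal fun i => (W i : ℂ)

omit [Fintype ι] in
theorem isHermitian_addPotential (hK : K.IsHermitian) (W : ι → ℝ) :
    (addPotential K W).IsHermitian :=
  hK.add <| isHermitian_diagonal_iff.2 fun i => Complex.conj_ofReal (W i)

omit [Fintype ι] in
theorem continuous_addPotential (K : Matrix ι ι ℂ) : Continuous (addPotential K) := by
  unfold addPotential
  fun_prop

omit [Fintype ι] in
theorem addPotential_update (K : Matrix ι ι ℂ) (W : ι → ℝ) (x : ι) (v : ℝ) :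
    addPotential K (Function.update W x v)
      = addPotential K (Function.update W x 0) + single x x (v : ℂ) := by
  rw [addPotential, addPotential, add_assoc, ← diagonal_single, diagonal_add]
  congr 2
  ext i
  rcases eq_or_ne i x with rfl | hi <;> simp [*]

theorem measurable_testVariation_addPotential (hK : K.IsHermitian) (U : Set ℝ) (x y : ι) :
    Measurable fun W => testVariation U fun f => cfc f (addPotential K W) x y :=
  (lowerSemicontinuous_testVariation U fun f =>
    (continuous_cfc_matrix (continuous_addPotential K) (isHermitian_addPotential hK)
      f.continuous).matrix_elem x y).measurable

theorem lintegral_testVariation_addPotential_le {s : ℝ} (hs0 : 0 ≤ s) (hs1 : s ≤ 1)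
    (hK : K.IsHermitian) {U : Set ℝ} (hU : MeasurableSet U) (x y : ι)
    {κ : Measure ℝ} [IsProbabilityMeasure κ] {M : ℝ} {N : ℝ≥0} (hM : ∀ᵐ v ∂κ, |v| ≤ M)
    (hN : κ ≤ N • volume) :
    ∫⁻ W, testVariation U (fun f => cfc f (addPotential K W) x y) ∂Measure.pi (fun _ : ι => κ)
      ≤ (N * ENNReal.ofReal (2 * M) ^ s) ^ (1 / (2 - s)) * (∫⁻ E in U, ∫⁻ W,
        ‖matrixGreen (addPotential K W) x y E‖ₑ ^ s ∂Measure.pi (fun _ : ι => κ))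
          ^ (1 / (2 - s)) := by
  set Q : (ι → ℝ) → ℝ≥0∞ := fun W => testVariation U fun f => cfc f (addPotential K W) x y
  have hQ : Measurable Q := measurable_testVariation_addPotential hK U x y
  have hG : Measurable fun q : (ι → ℝ) × ℝ => ‖matrixGreen (addPotential K q.1) x y q.2‖ₑ ^ s :=
    (measurable_matrixGreen ((continuous_addPotential K).comp continuous_fst) x y
      continuous_snd).enorm.pow_const s
  have hmoment : ∫⁻ W, Q W ^ (2 - s) ∂Measure.pi (fun _ : ι => κ)
      ≤ ∫⁻ W, N * ENNReal.ofReal (2 * M) ^ s *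
        (∫⁻ E in U, ‖matrixGreen (addPotential K W) x y E‖ₑ ^ s) ∂Measure.pi (fun _ : ι => κ) := by
    refine lintegral_le_of_lmarginal_le {x} (hQ.pow_const _)
      (hG.lintegral_prod_right'.const_mul _) fun W => ?_
    obtain ⟨K', hK', hupd⟩ : ∃ K' : Matrix ι ι ℂ, K'.IsHermitian ∧
        ∀ v, addPotential K (Function.update W x v) = K' + single x x (v : ℂ) :=
      ⟨_, isHermitian_addPotential hK _, addPotential_update K W x⟩
    simp only [lmarginal_singleton, Q, hupd]
    rw [lintegral_const_mul' _ _ (by finiteness)]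
    refine (lintegral_mono fun v => ?_).trans
      (lintegral_eigenCorrelator_rpow_le hK' hs0 hs1 hU x y hM hN)
    gcongr
    · linarith
    · exact testVariation_cfc_le_eigenCorrelator _ U x y
  refine (lintegral_le_lintegral_rpow _ (by linarith) hQ.aemeasurable).trans
    ((ENNReal.rpow_le_rpow hmoment (by simp; linarith)).trans_eq ?_)
  rw [lintegral_const_mul' _ _ (by finiteness), ENNReal.mul_rpow_of_nonneg _ _ (by simp; linarith),
    lintegral_lintegral_swap (by exact hG.aemeasurable)]

end IndependentPotential

/-! ### Strong convergence of compressions -/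

section StrongConvergence

open Polynomial

theorem continuous_cfc_fun {R B : Type*} {p : B → Prop} [CommSemiring R] [StarRing R]
    [MetricSpace R] [IsTopologicalSemiring R] [ContinuousStar R] [Ring B] [StarRing B]
    [TopologicalSpace B] [Algebra R B] [ContinuousFunctionalCalculus R B p] (b : B) :
    Continuous fun f : C(R, R) => cfc f b :=
  continuous_iff_continuousAt.2 fun _ => continuousAt_cfc_fun
    (ContinuousMap.tendsto_iff_forall_isCompact_tendstoUniformlyOn.1 tendsto_id _
      (ContinuousFunctionalCalculus.isCompact_spectrum b))
    (Eventually.of_forall fun g => g.continuous.continuousOn)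

theorem denseRange_toContinuousMap_real : DenseRange (toContinuousMap : ℝ[X] → C(ℝ, ℝ)) := by
  intro f
  have happrox (n : ℕ) : ∃ p : ℝ[X], ∀ x ∈ Set.Icc (-n : ℝ) n, |p.eval x - f x| < 1 / (n + 1) :=
    exists_polynomial_near_of_continuousOn _ _ f f.continuous.continuousOn _ (by positivity)
  choose p hp using happrox
  refine mem_closure_of_tendsto (f := fun n => (p n).toContinuousMap) (b := atTop) ?_
    (Eventually.of_forall fun n => ⟨p n, rfl⟩)
  refine ContinuousMap.tendsto_iff_forall_isCompact_tendstoUniformlyOn.2 fun K hK => ?_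
  obtain ⟨r, hr⟩ := hK.isBounded.exists_norm_le
  refine Metric.tendstoUniformlyOn_iff.2 fun ε hε => ?_
  filter_upwards [tendsto_one_div_add_atTop_nhds_zero_nat.eventually_lt_const hε,
    tendsto_natCast_atTop_atTop.eventually_ge_atTop r] with n hnε hnr x hx
  rw [dist_comm]
  exact (hp n x (abs_le.1 ((hr x hx).trans hnr))).trans hnε

theorem norm_cfc_le_of_norm_le {B : Type*} [CStarAlgebra B] {a : B} {R c : ℝ} (haR : ‖a‖ ≤ R)
    {f : ℝ → ℝ} (hc : 0 ≤ c) (hf : ∀ x ∈ Set.Icc (-R) R, |f x| ≤ c) : ‖cfc f a‖ ≤ c := by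
  by_cases ha : IsSelfAdjoint a
  · refine norm_cfc_le hc fun x hx => hf x (abs_le.1 ?_)
    calc |x| ≤ ‖cfc (id : ℝ → ℝ) a‖ := norm_apply_le_norm_cfc id a hx
      _ ≤ R := by rwa [cfc_id ℝ a]
  · rwa [cfc_apply_of_not_predicate a ha, norm_zero]

variable {E I : Type*} [NormedAddCommGroup E] {l : Filter I} {R : ℝ}

theorem tendsto_clm_apply_of_opNorm_le [NormedSpace ℂ E] {T : I → E →L[ℂ] E} {S : E →L[ℂ] E}
    (hR : ∀ i, ‖T i‖ ≤ R) (hT : ∀ v, Tendsto (fun i => T i v) l (𝓝 (S v)))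
    {u : I → E} {v : E} (hu : Tendsto u l (𝓝 v)) :
    Tendsto (fun i => T i (u i)) l (𝓝 (S v)) := by
  have hsmall : Tendsto (fun i => T i (u i - v)) l (𝓝 0) := by
    refine squeeze_zero_norm (a := fun i => R * ‖u i - v‖)
      (fun i => (T i).le_of_opNorm_le (hR i) _) ?_
    simpa using (tendsto_sub_nhds_zero_iff.2 hu).norm.const_mul R
  simpa using hsmall.add (hT v)

theorem tendsto_aeval_apply [NormedSpace ℂ E] {T : I → E →L[ℂ] E} {S : E →L[ℂ] E}
    (hR : ∀ i, ‖T i‖ ≤ R) (hT : ∀ v, Tendsto (fun i => T i v) l (𝓝 (S v))) (p : ℝ[X]) (v : E) :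
    Tendsto (fun i => aeval (T i) p v) l (𝓝 (aeval S p v)) := by
  induction p using Polynomial.induction_on' with
  | add p q hp hq => simpa only [map_add, add_apply] using hp.add hq
  | monomial n c =>
    have hpow : Tendsto (fun i => (T i ^ n) v) l (𝓝 ((S ^ n) v)) := by
      induction n with
      | zero => simpa only [pow_zero] using tendsto_const_nhds
      | succ n ih =>
        simpa only [pow_succ', mul_apply_eq_comp] using tendsto_clm_apply_of_opNorm_le hR hT ih
    simpa only [aeval_monomial, ← Algebra.smul_def, smul_apply] using hpow.const_smul c

theorem equicontinuous_cfc_apply [InnerProductSpace ℂ E] [CompleteSpace E] {T : I → E →L[ℂ] E}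
    (hR : ∀ i, ‖T i‖ ≤ R) (v : E) : Equicontinuous fun i (f : C(ℝ, ℝ)) => cfc f (T i) v := by
  intro f
  refine Metric.equicontinuousAt_iff_right.2 fun ε hε => ?_
  have hδ : 0 < ε / (‖v‖ + 1) := by positivity
  have hnear := Metric.tendstoUniformlyOn_iff.1
    (ContinuousMap.tendsto_iff_forall_isCompact_tendstoUniformlyOn.1
      (tendsto_id (x := 𝓝 f)) _ (isCompact_Icc (a := -R) (b := R))) _ hδ
  filter_upwards [hnear] with g hg i
  have hop : ‖cfc (fun x => f x - g x) (T i)‖ ≤ ε / (‖v‖ + 1) :=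
    norm_cfc_le_of_norm_le (hR i) hδ.le fun x hx => (hg x hx).le
  calc dist (cfc f (T i) v) (cfc g (T i) v) = ‖cfc (fun x => f x - g x) (T i) v‖ := by
        rw [cfc_sub (f : ℝ → ℝ) g (T i), sub_apply, dist_eq_norm]
    _ ≤ ε / (‖v‖ + 1) * ‖v‖ := ContinuousLinearMap.le_of_opNorm_le _ hop v
    _ < ε / (‖v‖ + 1) * (‖v‖ + 1) := by gcongr; exact lt_add_one _
    _ = ε := div_mul_cancel₀ _ (by positivity)

theorem tendsto_cfc_apply [InnerProductSpace ℂ E] [CompleteSpace E] {T : I → E →L[ℂ] E}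
    {S : E →L[ℂ] E} (hTsa : ∀ i, IsSelfAdjoint (T i)) (hSsa : IsSelfAdjoint S)
    (hR : ∀ i, ‖T i‖ ≤ R) (hT : ∀ v, Tendsto (fun i => T i v) l (𝓝 (S v)))
    (f : C(ℝ, ℝ)) (v : E) : Tendsto (fun i => cfc f (T i) v) l (𝓝 (cfc f S v)) := by
  have hclosed : IsClosed {f : C(ℝ, ℝ) | Tendsto (fun i => cfc f (T i) v) l (𝓝 (cfc f S v))} :=
    (equicontinuous_cfc_apply hR v).isClosed_setOfPred_tendsto
      ((ContinuousLinearMap.apply ℂ E v).continuous.comp (continuous_cfc_fun S))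
  refine denseRange_toContinuousMap_real.induction_on f hclosed fun p => ?_
  have hp {A : E →L[ℂ] E} (hA : IsSelfAdjoint A) : cfc p.toContinuousMap A = aeval A p :=
    cfc_polynomial p A hA
  simpa only [hp (hTsa _), hp hSsa] using tendsto_aeval_apply hR hT p v

end StrongConvergence

section Compression

open Polynomial

variable {E J : Type*} [NormedAddCommGroup E] [InnerProductSpace ℂ E] {b : J → E}

/-- The orthogonal projection onto the span of `b j`, `j ∈ S`, for an orthonormal family `b`. -/
noncomputable def spanProj (b : J → E) (S : Finset J) : E →L[ℂ] E :=
  ∑ j ∈ S, InnerProductSpace.rankOne ℂ (b j) (b j)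

theorem spanProj_apply (b : J → E) (S : Finset J) (v : E) :
    spanProj b S v = ∑ j ∈ S, inner ℂ (b j) v • b j := by
  simp only [spanProj, sum_apply, InnerProductSpace.rankOne_apply]

theorem tendsto_spanProj_apply (b : HilbertBasis J ℂ E) (v : E) :
    Tendsto (fun S => spanProj b S v) atTop (𝓝 v) := by
  simpa only [spanProj_apply, HilbertBasis.repr_apply_apply, HasSum,
    SummationFilter.unconditional_filter] using b.hasSum_repr v

variable [CompleteSpace E]

theorem continuous_cfcElement (T : E →L[ℂ] E) (φ ψ : E) : Continuous (cfcElement T φ ψ) :=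
  continuous_const.inner ((ContinuousLinearMap.apply ℂ E ψ).continuous.comp (continuous_cfc_fun T))

theorem isStarProjection_spanProj (hb : Orthonormal ℂ b) (S : Finset J) :
    IsStarProjection (spanProj b S) where
  isIdempotentElem := by
    ext v
    rw [mul_apply_eq_comp, spanProj_apply b S (spanProj b S v), spanProj_apply]
    exact Finset.sum_congr rfl fun j hj => by rw [hb.inner_right_sum _ hj]
  isSelfAdjoint := isSelfAdjoint_sum _ fun j _ =>
    (InnerProductSpace.isStarProjection_rankOne_self (hb.1 j)).isSelfAdjoint

/-- The compression `P T P` of `T` to the span of `b j`, `j ∈ S`, as an operator on the whole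
space. -/
noncomputable def compression (b : J → E) (T : E →L[ℂ] E) (S : Finset J) : E →L[ℂ] E :=
  spanProj b S * T * spanProj b S

theorem isSelfAdjoint_compression (hb : Orthonormal ℂ b) {T : E →L[ℂ] E} (hT : IsSelfAdjoint T)
    (S : Finset J) : IsSelfAdjoint (compression b T S) := by
  have hP : star (spanProj b S) = spanProj b S := (isStarProjection_spanProj hb S).isSelfAdjoint
  simpa only [compression, hP] using hT.conjugate (spanProj b S)

theorem norm_compression_le (hb : Orthonormal ℂ b) (T : E →L[ℂ] E) (S : Finset J) :
    ‖compression b T S‖ ≤ ‖T‖ := by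
  have hP := (isStarProjection_spanProj hb S).norm_le
  calc ‖compression b T S‖ ≤ ‖spanProj b S‖ * ‖T‖ * ‖spanProj b S‖ := norm_mul₃_le
    _ ≤ 1 * ‖T‖ * 1 := by gcongr
    _ = ‖T‖ := by ring

theorem tendsto_compression_apply (b : HilbertBasis J ℂ E) (T : E →L[ℂ] E) (v : E) :
    Tendsto (fun S => compression b T S v) atTop (𝓝 (T v)) :=
  tendsto_clm_apply_of_opNorm_le (S := 1)
    (fun S => (isStarProjection_spanProj b.orthonormal S).norm_le)
    (tendsto_spanProj_apply b) ((T.continuous.tendsto v).comp (tendsto_spanProj_apply b v))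

theorem tendsto_cfcElement_compression (b : HilbertBasis J ℂ E) {T : E →L[ℂ] E}
    (hT : IsSelfAdjoint T) (φ ψ : E) (f : C(ℝ, ℝ)) :
    Tendsto (fun S => cfcElement (compression b T S) φ ψ f) atTop (𝓝 (cfcElement T φ ψ f)) :=
  tendsto_const_nhds.inner <| tendsto_cfc_apply (isSelfAdjoint_compression b.orthonormal hT) hT
    (norm_compression_le b.orthonormal T) (tendsto_compression_apply b T) f ψ

/-- The matrix `(⟨b i, T b j⟩)` of the compression of `T` to the span of `b j`, `j ∈ S`. -/
noncomputable def compressionMatrix (b : J → E) (T : E →L[ℂ] E) (S : Finset J) : Matrix S S ℂ :=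
  Matrix.of fun i j => inner ℂ (b i) (T (b j))

theorem isHermitian_compressionMatrix {T : E →L[ℂ] E} (hT : IsSelfAdjoint T) (S : Finset J) :
    (compressionMatrix b T S).IsHermitian := by
  ext i j
  exact (inner_conj_symm _ _).trans (hT.isSymmetric _ _)

variable [DecidableEq J]

theorem compressionMatrix_pow_apply (hb : Orthonormal ℂ b) (T : E →L[ℂ] E) (S : Finset J) (n : ℕ)
    (i j : S) :
    (compressionMatrix b T S ^ n) i j = inner ℂ (b i) ((compression b T S ^ n) (b j)) := by
  induction n generalizing i with
  | zero =>
    simp only [pow_zero, Matrix.one_apply, one_apply_eq_self, orthonormal_iff_ite.1 hb,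
      Subtype.ext_iff]
  | succ n ih =>
    have hP := isStarProjection_spanProj hb S
    have hPb : spanProj b S (b i) = b i := by
      simp [spanProj_apply, orthonormal_iff_ite.1 hb]
    set w := (compression b T S ^ n) (b j)
    calc (compressionMatrix b T S ^ (n + 1)) i j
        = ∑ k : S, inner ℂ (b i) (T (b k)) * inner ℂ (b k) w := by
          rw [pow_succ', Matrix.mul_apply]
          exact Finset.sum_congr rfl fun k _ => congrArg _ (ih k)
      _ = inner ℂ (b i) (T (spanProj b S w)) := by
          rw [spanProj_apply, map_sum, inner_sum, ← Finset.sum_coe_sort S]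
          exact Finset.sum_congr rfl fun k _ => by rw [map_smul, inner_smul_right, mul_comm]
      _ = inner ℂ (b i) (compression b T S w) := by
          rw [compression, mul_assoc, mul_apply_eq_comp, ← hP.isSelfAdjoint.isSymmetric.apply_clm,
            hPb, mul_apply_eq_comp]
      _ = inner ℂ (b i) ((compression b T S ^ (n + 1)) (b j)) := by
          rw [pow_succ', mul_apply_eq_comp]

theorem compressionMatrix_aeval_apply (hb : Orthonormal ℂ b) (T : E →L[ℂ] E) (S : Finset J)
    (p : ℝ[X]) (i j : S) :
    aeval (compressionMatrix b T S) p i j = inner ℂ (b i) (aeval (compression b T S) p (b j)) := by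
  induction p using Polynomial.induction_on' with
  | add p q hp hq => simp only [map_add, Matrix.add_apply, add_apply, inner_add_right, hp, hq]
  | monomial n c =>
    simp only [aeval_monomial, ← Algebra.smul_def, Matrix.smul_apply, smul_apply,
      compressionMatrix_pow_apply hb, inner_smul_right_eq_smul]

theorem cfc_compressionMatrix_apply (hb : Orthonormal ℂ b) {T : E →L[ℂ] E}
    (hT : IsSelfAdjoint T) (S : Finset J) (f : C(ℝ, ℝ)) (i j : S) :
    cfc f (compressionMatrix b T S) i j = cfcElement (compression b T S) (b i) (b j) f := by
  refine denseRange_toContinuousMap_real.induction_on f (isClosed_eq ?_ ?_) fun p => ?_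
  · exact (continuous_cfc_fun _).matrix_elem i j
  · exact continuous_cfcElement _ _ _
  · have hA : cfc p.toContinuousMap (compressionMatrix b T S) = aeval (compressionMatrix b T S) p :=
      cfc_polynomial p _ (isHermitian_compressionMatrix hT S)
    have hC : cfc p.toContinuousMap (compression b T S) = aeval (compression b T S) p :=
      cfc_polynomial p _ (isSelfAdjoint_compression hb hT S)
    rw [cfcElement, hA, hC, compressionMatrix_aeval_apply hb]

end Compression

/-! ### Restrictions of the lattice Hamiltonian to boxes -/

section Lattice

variable {d : ℕ}

theorem inner_basisVec_left (x : Fin d → ℤ) (v : LatticeL2 d) : inner ℂ (basisVec x) v = v x := by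
  rw [basisVec, lp.inner_single_left]
  simp

theorem basisVec_apply (x z : Fin d → ℤ) : basisVec x z = if x = z then (1 : ℂ) else 0 := by
  rw [basisVec, lp.single_apply, Pi.single_apply]
  simp only [eq_comm]

/-- The canonical Hilbert basis of `ℓ²(ℤ^d)`. -/
noncomputable def latticeBasis (d : ℕ) : HilbertBasis (Fin d → ℤ) ℂ (LatticeL2 d) :=
  .ofRepr (.refl ℂ _)

theorem coe_latticeBasis : ⇑(latticeBasis d) = basisVec := by
  funext x
  exact ((latticeBasis d).repr_symm_single x).symm

theorem orthonormal_basisVec : Orthonormal ℂ (basisVec (d := d)) :=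
  coe_latticeBasis (d := d) ▸ (latticeBasis d).orthonormal

theorem eq_single_or_eq_neg_single_of_sum_abs_eq_one {k : Fin d → ℤ} (hk : ∑ i, |k i| = 1) :
    ∃ j, k = Pi.single j 1 ∨ k = -Pi.single j 1 := by
  obtain ⟨j, -, hj⟩ := Finset.exists_ne_zero_of_sum_ne_zero (hk.trans_ne one_ne_zero)
  have hle (i : Fin d) (hi : i ≠ j) : |k j| + |k i| ≤ 1 :=
    (Finset.add_le_sum (fun i _ => abs_nonneg (k i)) (Finset.mem_univ _) (Finset.mem_univ _)
      hi.symm).trans_eq hk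
  have hj1 : 1 ≤ |k j| := Int.one_le_abs (abs_ne_zero.1 hj)
  have hrest (i : Fin d) (hi : i ≠ j) : k i = 0 :=
    abs_nonpos_iff.1 (by linarith [hle i hi])
  have hj2 : |k j| ≤ 1 :=
    (Finset.single_le_sum (fun i _ => abs_nonneg (k i)) (Finset.mem_univ j)).trans_eq hk
  refine ⟨j, (eq_or_eq_neg_of_abs_eq (le_antisymm hj2 hj1)).imp (fun h => ?_) fun h => ?_⟩ <;>
  · ext i
    rcases eq_or_ne i j with rfl | hi
    · simp [h]
    · simp [hi, hrest i hi]

theorem sum_ite_eq_single_add_ite_eq_neg_single (k : Fin d → ℤ) :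
    ∑ j, ((if k = Pi.single j 1 then (1 : ℂ) else 0) + if k = -Pi.single j 1 then 1 else 0)
      = if ∑ i, |k i| = 1 then 1 else 0 := by
  have hne (i j : Fin d) : (Pi.single i 1 : Fin d → ℤ) ≠ -Pi.single j 1 := fun h => by
    have hi := congrFun h i
    rw [Pi.single_eq_same, Pi.neg_apply, Pi.single_apply] at hi
    split_ifs at hi
    all_goals simp at hi
  have hinj (i j : Fin d) : (Pi.single i 1 : Fin d → ℤ) = Pi.single j 1 ↔ i = j :=
    ⟨fun h => by_contra fun hij => by simpa [hij] using congrFun h i, fun h => h ▸ rfl⟩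
  have habs (j : Fin d) : ∑ i, |(Pi.single j 1 : Fin d → ℤ) i| = 1 := by
    rw [Finset.sum_eq_single j] <;> simp +contextual
  split_ifs with hk
  · obtain ⟨j, rfl | rfl⟩ := eq_single_or_eq_neg_single_of_sum_abs_eq_one hk
    · simp [hne, hinj]
    · simp [hinj, (hne _ _).symm]
  · refine Finset.sum_eq_zero fun j _ => ?_
    rw [if_neg, if_neg, add_zero]
    · rintro rfl
      exact hk (by simpa using habs j)
    · rintro rfl
      exact hk (habs j)

theorem eventually_mem_latticeBox (z : Fin d → ℤ) : ∀ᶠ L : ℕ in atTop, z ∈ latticeBox d L := by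
  filter_upwards [eventually_ge_atTop (∑ i, (z i).natAbs)] with L hL
  have h (i : Fin d) : |z i| ≤ L := by
    rw [Int.abs_eq_natAbs]
    exact mod_cast (Finset.single_le_sum (fun i _ => Nat.zero_le (z i).natAbs)
      (Finset.mem_univ i)).trans hL
  exact Finset.mem_Icc.2 ⟨fun i => (abs_le.1 (h i)).1, fun i => (abs_le.1 (h i)).2⟩

theorem tendsto_latticeBox : Tendsto (latticeBox d) atTop atTop :=
  tendsto_atTop.2 fun S => (S.eventually_all.2 fun z _ => eventually_mem_latticeBox z)

variable {V : (Fin d → ℤ) → ℝ} {M : ℝ}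

theorem boxHamiltonian_eq_compressionMatrix (hM : ∀ n, |V n| ≤ M) (L : ℕ) :
    boxHamiltonian V L = compressionMatrix basisVec (andersonOp V) (latticeBox d L) := by
  ext n m
  have hplus (j : Fin d) : m.1 = n.1 + Pi.single j 1 ↔ m.1 - n.1 = Pi.single j 1 :=
    sub_eq_iff_eq_add'.symm
  have hminus (j : Fin d) : m.1 = n.1 - Pi.single j 1 ↔ m.1 - n.1 = -Pi.single j 1 := by
    rw [sub_eq_iff_eq_add', sub_eq_add_neg]
  have hsum : ∑ i, |n.1 i - m.1 i| = ∑ i, |(m.1 - n.1) i| :=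
    Finset.sum_congr rfl fun i _ => abs_sub_comm _ _
  simp only [compressionMatrix, boxHamiltonian, Matrix.of_apply, inner_basisVec_left,
    andersonOp_apply V M hM, basisVec_apply, hplus, hminus, hsum,
    sum_ite_eq_single_add_ite_eq_neg_single, mul_ite, mul_one, mul_zero, Subtype.ext_iff]
  congr 1
  · split_ifs <;> simp
  · simp only [eq_comm]

theorem boxHamiltonian_eq_addPotential (V : (Fin d → ℤ) → ℝ) (L : ℕ) :
    boxHamiltonian V L = addPotential (boxHamiltonian 0 L) fun n => V n := by
  ext n m
  simp [boxHamiltonian, addPotential, Matrix.diagonal_apply]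

theorem isHermitian_boxHamiltonian (V : (Fin d → ℤ) → ℝ) (L : ℕ) :
    (boxHamiltonian V L).IsHermitian := by
  have h0 : (boxHamiltonian (0 : (Fin d → ℤ) → ℝ) L).IsHermitian :=
    boxHamiltonian_eq_compressionMatrix (V := 0) (fun _ => abs_zero.le) L ▸
      isHermitian_compressionMatrix (isSelfAdjoint_andersonOp 0) _
  exact boxHamiltonian_eq_addPotential V L ▸ isHermitian_addPotential h0 _

theorem continuous_boxHamiltonian (L : ℕ) :
    Continuous fun V : (Fin d → ℤ) → ℝ => boxHamiltonian V L := by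
  rw [funext fun V => boxHamiltonian_eq_addPotential V L]
  exact (continuous_addPotential _).comp (by fun_prop)

open Classical in
/-- The matrix element `⟨e_x, f(h^{Λ_L}) e_y⟩` of the restriction of `h₀ + V` to `ℓ²(Λ_L)`. Like
`boxGreen`, it is set to `0` if `x ∉ Λ_L` or `y ∉ Λ_L`. -/
noncomputable def boxFun (V : (Fin d → ℤ) → ℝ) (L : ℕ) (x y : Fin d → ℤ) (f : C(ℝ, ℝ)) : ℂ :=
  if h : x ∈ latticeBox d L ∧ y ∈ latticeBox d L then
    cfc f (boxHamiltonian V L) ⟨x, h.1⟩ ⟨y, h.2⟩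
  else 0

theorem continuous_boxFun (L : ℕ) (x y : Fin d → ℤ) (f : C(ℝ, ℝ)) :
    Continuous fun V => boxFun V L x y f := by
  unfold boxFun
  split_ifs
  · exact (continuous_cfc_matrix (continuous_boxHamiltonian L)
      (fun V => isHermitian_boxHamiltonian V L) f.continuous).matrix_elem _ _
  · exact continuous_const

theorem tendsto_boxFun (hM : ∀ n, |V n| ≤ M) (x y : Fin d → ℤ) (f : C(ℝ, ℝ)) :
    Tendsto (fun L => boxFun V L x y f) atTop
      (𝓝 (cfcElement (andersonOp V) (basisVec x) (basisVec y) f)) := by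
  have hV := isSelfAdjoint_andersonOp V
  have hlim := (tendsto_cfcElement_compression (latticeBasis d) hV (basisVec x) (basisVec y) f).comp
    tendsto_latticeBox
  refine hlim.congr' ?_
  filter_upwards [eventually_mem_latticeBox x, eventually_mem_latticeBox y] with L hx hy
  rw [boxFun, dif_pos ⟨hx, hy⟩, boxHamiltonian_eq_compressionMatrix hM,
    cfc_compressionMatrix_apply orthonormal_basisVec hV, Function.comp_apply, coe_latticeBasis]

end Lattice

/-! ### The random potential -/

section Density

variable {ρ : ℝ → ℝ}

theorem IsBoundedCompactDensity.exists_withDensity_le (hρ : IsBoundedCompactDensity ρ) :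
    ∃ N : ℝ≥0, (volume.withDensity fun v => ENNReal.ofReal (ρ v)) ≤ N • volume := by
  lift eLpNorm ρ ∞ volume to ℝ≥0 using hρ.memLp_top.eLpNorm_ne_top with N hN
  refine ⟨N, (withDensity_mono (g := fun _ => (N : ℝ≥0∞)) ?_).trans_eq (withDensity_const _)⟩
  filter_upwards [ae_le_eLpNormEssSup (f := ρ) (μ := volume)] with v hv
  rw [hN, eLpNorm_exponent_top]
  exact (Real.ofReal_le_enorm _).trans hv

theorem IsBoundedCompactDensity.exists_ae_abs_le (hρ : IsBoundedCompactDensity ρ) :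
    ∃ M : ℝ, ∀ᵐ v ∂(volume.withDensity fun v => ENNReal.ofReal (ρ v)), |v| ≤ M := by
  obtain ⟨K, hK, hKρ⟩ := hρ.compact_support
  obtain ⟨M, hM⟩ := hK.isBounded.exists_norm_le
  refine ⟨M, ?_⟩
  rw [ae_withDensity_iff' hρ.memLp_top.aestronglyMeasurable.aemeasurable.ennreal_ofReal]
  filter_upwards [hKρ] with v hv
  contrapose!
  intro hvM
  rw [hv fun hvK => hvM.not_ge (hM v hvK), ENNReal.ofReal_zero]

end Density

section Random

variable {d : ℕ} {Ω : Type*} [MeasurableSpace Ω] {P : Measure Ω} {ω : (Fin d → ℤ) → Ω → ℝ}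
  {ρ : ℝ → ℝ}

theorem IsIIDPotential.measurable_potential (h : IsIIDPotential P ω ρ) :
    Measurable fun t n => ω n t :=
  measurable_pi_lambda _ h.measurable

theorem IsIIDPotential.ae_forall_abs_le (h : IsIIDPotential P ω ρ) {M : ℝ}
    (hM : ∀ᵐ v ∂(volume.withDensity fun v => ENNReal.ofReal (ρ v)), |v| ≤ M) :
    ∀ᵐ t ∂P, ∀ n, |ω n t| ≤ M :=
  ae_all_iff.2 fun n => ae_of_ae_map (h.measurable n).aemeasurable (h.law n ▸ hM)

theorem IsIIDPotential.measurable_boxFun (h : IsIIDPotential P ω ρ) (L : ℕ) (x y : Fin d → ℤ)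
    (f : C(ℝ, ℝ)) : Measurable fun t => boxFun (fun n => ω n t) L x y f :=
  (continuous_boxFun L x y f).measurable.comp h.measurable_potential

theorem IsIIDPotential.measurable_testVariation_boxFun (h : IsIIDPotential P ω ρ) (L : ℕ)
    (x y : Fin d → ℤ) (U : Set ℝ) :
    Measurable fun t => testVariation U (boxFun (fun n => ω n t) L x y) :=
  (lowerSemicontinuous_testVariation U (continuous_boxFun L x y)).measurable.comp
    h.measurable_potential

theorem IsIIDPotential.aemeasurable_variation (h : IsIIDPotential P ω ρ) {M : ℝ}
    (hM : ∀ᵐ v ∂(volume.withDensity fun v => ENNReal.ofReal (ρ v)), |v| ≤ M)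
    (x y : Fin d → ℤ) {U : Set ℝ} (hU : IsOpen U) :
    AEMeasurable (fun t => (mixedSpectralMeasure (andersonOp fun n => ω n t)
      (basisVec x) (basisVec y)).variation U) P := by
  simp only [variation_mixedSpectralMeasure _ _ _ hU]
  refine aemeasurable_testVariation U (fun t => continuous_cfcElement _ _ _) fun f => ?_
  refine aemeasurable_of_tendsto_metrizable_ae'
    (fun L => (h.measurable_boxFun L x y f).aemeasurable) ?_
  filter_upwards [h.ae_forall_abs_le hM] with t ht using tendsto_boxFun ht x y f

theorem variation_le_liminf_testVariation_boxFun {V : (Fin d → ℤ) → ℝ} {M : ℝ}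
    (hM : ∀ n, |V n| ≤ M) (x y : Fin d → ℤ) {U : Set ℝ} (hU : IsOpen U) :
    (mixedSpectralMeasure (andersonOp V) (basisVec x) (basisVec y)).variation U
      ≤ liminf (fun L => testVariation U (boxFun V L x y)) atTop :=
  (variation_mixedSpectralMeasure _ _ _ hU).trans_le <|
    testVariation_le_liminf U fun f _ => tendsto_boxFun hM x y f

variable [IsProbabilityMeasure P]

theorem IsIIDPotential.map_box (h : IsIIDPotential P ω ρ) (L : ℕ) :
    P.map (fun t (n : latticeBox d L) => ω n t)
      = Measure.pi fun _ => volume.withDensity fun v => ENNReal.ofReal (ρ v) := by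
  have hindep := h.indep.precomp (g := fun n : latticeBox d L => n.1) Subtype.val_injective
  rw [(iIndepFun_iff_map_fun_eq_pi_map fun n => (h.measurable _).aemeasurable).1 hindep]
  simp only [h.law]

theorem IsIIDPotential.lintegral_testVariation_boxFun_le (h : IsIIDPotential P ω ρ) {s : ℝ}
    (hs0 : 0 ≤ s) (hs1 : s ≤ 1) {M : ℝ} {N : ℝ≥0}
    (hM : ∀ᵐ v ∂(volume.withDensity fun v => ENNReal.ofReal (ρ v)), |v| ≤ M)
    (hN : (volume.withDensity fun v => ENNReal.ofReal (ρ v)) ≤ N • volume)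
    {U : Set ℝ} (hU : MeasurableSet U) {L : ℕ} {x y : Fin d → ℤ}
    (hx : x ∈ latticeBox d L) (hy : y ∈ latticeBox d L) :
    ∫⁻ t, testVariation U (boxFun (fun n => ω n t) L x y) ∂P
      ≤ (N * ENNReal.ofReal (2 * M) ^ s) ^ (1 / (2 - s)) *
        (∫⁻ E in U, ∫⁻ t, ‖boxGreen (fun n => ω n t) L x y E‖ₑ ^ s ∂P) ^ (1 / (2 - s)) := by
  have : IsProbabilityMeasure (volume.withDensity fun v => ENNReal.ofReal (ρ v)) :=
    h.law 0 ▸ Measure.isProbabilityMeasure_map (h.measurable 0).aemeasurable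
  have hres : Measurable fun t (n : latticeBox d L) => ω n t :=
    measurable_pi_lambda _ fun n => h.measurable n
  have hK := isHermitian_boxHamiltonian (0 : (Fin d → ℤ) → ℝ) L
  have hfun (t : Ω) : boxFun (fun n => ω n t) L x y = fun f : C(ℝ, ℝ) =>
      cfc f (addPotential (boxHamiltonian 0 L) fun n => ω n t) ⟨x, hx⟩ ⟨y, hy⟩ := by
    ext f
    rw [boxFun, dif_pos ⟨hx, hy⟩, boxHamiltonian_eq_addPotential]
  have hgreen (t : Ω) (E : ℝ) : boxGreen (fun n => ω n t) L x y E =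
      matrixGreen (addPotential (boxHamiltonian 0 L) fun n => ω n t) ⟨x, hx⟩ ⟨y, hy⟩ E := by
    rw [boxGreen, dif_pos ⟨hx, hy⟩, boxHamiltonian_eq_addPotential]
    rfl
  have hbox := lintegral_testVariation_addPotential_le hs0 hs1 hK hU ⟨x, hx⟩ ⟨y, hy⟩ hM hN
  rw [← h.map_box L, lintegral_map (measurable_testVariation_addPotential hK U _ _) hres] at hbox
  simp only [hfun, hgreen]
  have hexp : 0 ≤ 1 / (2 - s) := one_div_nonneg.2 (by linarith)
  grw [hbox]
  gcongr
  exact lintegral_map_le _ _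

end Random

theorem proposition6p1_general (d : ℕ) (s : ℝ) (hs0 : 0 ≤ s) (hs1 : s ≤ 1)
    (ρ : ℝ → ℝ) (hρ : IsBoundedCompactDensity ρ) :
    ∃ C : ℝ≥0, ∀ (Ω : Type*) [MeasurableSpace Ω] (P : Measure Ω) [IsProbabilityMeasure P]
      (ω : (Fin d → ℤ) → Ω → ℝ), IsIIDPotential P ω ρ →
      ∀ (U : Set ℝ), IsOpen U → ∀ x y : Fin d → ℤ,
        AEMeasurable (fun t : Ω =>
          (mixedSpectralMeasure (andersonOp fun n => ω n t) (basisVec x) (basisVec y)).variation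
            U) P ∧
        ∫⁻ t, (mixedSpectralMeasure (andersonOp fun n => ω n t)
            (basisVec x) (basisVec y)).variation U ∂P
          ≤ C * liminf (fun L : ℕ =>
              (∫⁻ E in U, ∫⁻ t, ‖boxGreen (fun n => ω n t) L x y E‖ₑ ^ s ∂P) ^ (1 / (2 - s)))
                atTop := by
  obtain ⟨N, hN⟩ := hρ.exists_withDensity_le
  obtain ⟨M, hM⟩ := hρ.exists_ae_abs_le
  have hC : (N * ENNReal.ofReal (2 * M) ^ s) ^ (1 / (2 - s)) ≠ ∞ :=
    ENNReal.rpow_ne_top_of_nonneg (one_div_nonneg.2 (by linarith)) (by finiteness)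
  refine ⟨((N * ENNReal.ofReal (2 * M) ^ s) ^ (1 / (2 - s))).toNNReal,
    fun Ω _ P _ ω h U hU x y => ⟨h.aemeasurable_variation hM x y hU, ?_⟩⟩
  rw [ENNReal.coe_toNNReal hC, ← ENNReal.liminf_const_mul_of_ne_top hC]
  calc ∫⁻ t, (mixedSpectralMeasure (andersonOp fun n => ω n t)
        (basisVec x) (basisVec y)).variation U ∂P
      ≤ ∫⁻ t, liminf (fun L => testVariation U (boxFun (fun n => ω n t) L x y)) atTop ∂P := by
        refine lintegral_mono_ae ?_
        filter_upwards [h.ae_forall_abs_le hM] with t ht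
        exact variation_le_liminf_testVariation_boxFun ht x y hU
    _ ≤ liminf (fun L => ∫⁻ t, testVariation U (boxFun (fun n => ω n t) L x y) ∂P) atTop :=
        lintegral_liminf_le fun L => h.measurable_testVariation_boxFun L x y U
    _ ≤ _ := by
        refine liminf_le_liminf ?_
        filter_upwards [eventually_mem_latticeBox x, eventually_mem_latticeBox y] with L hx hy
        exact h.lintegral_testVariation_boxFun_le hs0 hs1 hM hN hU.measurableSet hx hy

theorem proposition6p1 (d : ℕ) (hd : 1 ≤ d) (s : ℝ) (hs0 : 0 < s) (hs1 : s < 1)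
    (ρ : ℝ → ℝ) (hρ : IsBoundedCompactDensity ρ) :
    ∃ C : ℝ≥0, ∀ (Ω : Type*) [MeasurableSpace Ω] (P : Measure Ω) [IsProbabilityMeasure P]
      (ω : (Fin d → ℤ) → Ω → ℝ), IsIIDPotential P ω ρ →
      ∀ (a b : ℝ) (x y : Fin d → ℤ),
        AEMeasurable (fun t : Ω =>
          (mixedSpectralMeasure (andersonOp fun n => ω n t) (basisVec x) (basisVec y)).variation
            (Set.Ioo a b)) P ∧
        ∫⁻ t, (mixedSpectralMeasure (andersonOp fun n => ω n t)
            (basisVec x) (basisVec y)).variation (Set.Ioo a b) ∂P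
          ≤ C * liminf (fun L : ℕ =>
              (∫⁻ E in Set.Ioo a b,
                ∫⁻ t, ‖boxGreen (fun n => ω n t) L x y E‖ₑ ^ s ∂P) ^ (1 / (2 - s))) atTop := by
  obtain ⟨C, hC⟩ := proposition6p1_general d s hs0.le hs1.le ρ hρ
  exact ⟨C, fun Ω _ P _ ω h a b => hC Ω P ω h (Set.Ioo a b) isOpen_Ioo⟩
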